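/- Conventions. Let $A$ be a unital $C^*$-algebra. Hilbert $A$-modules are complete right modules with $A$-valued inner product that is $A$-linear in the second variable. A correspondence $M$ over $A$ is a Hilbert $A$-module with a left action of $A$ by adjointable operators; it is assumed essential, i.e. $1\cdot m=m$ for all $m\in M$. $X\otimes_A M$ is the internal tensor product: the Hilbert module completion of $X\odot M$ for $\langle x\otimes m,y\otimes n\rangle=\langle\langle y,x\rangle\cdot m,n\rangle$. A countable family $(x_i)$ in a submodule $V$ of a Hilbert module is a Parseval frame for $V$ if $\langle y,y\rangle=\sum_i\langle y,x_i\rangle\langle x_i,y\rangle$ for all $y\in V$, with unconditional norm convergence. It is an orthonormal basis for $V$ if $\langle x_i,x_j\rangle=\delta_{ij}1$ and $V$ is contained in the closed $A$-submodule generated by the $x_i$. Let $m\in M$ with $\langle m,m\rangle=1$. Then $M_\infty$, with canonical maps $\iota^k:M^{\otimes k}\to M_\infty$, denotes the Hilbert-module direct limit of $A\to M\to M^{\otimes 2}\to\cdots$ with respect to the inner-product preserving maps $n\mapsto m\otimes n$ (and $a\mapsto m\cdot a$ for $k=0$), where $M^{\otimes 0}=A$ and $A\otimes_AM^{\otimes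 k}$ is identified with $M^{\otimes k}$. A scaling function for $m$ is a triple $(X,D,\phi)$ in which $X$ is a Hilbert $A$-module, $D:X\to X\otimes_AM$ is an isomorphism of Hilbert modules, and $\phi\in X$ satisfies $\langle\phi,\phi\rangle=1$ and $D\phi=\phi\otimes m$. The powers of $D$ are the isomorphisms $D^k:X\to X\otimes_AM^{\otimes k}$ given by $D^0=\mathrm{id}$, $D^{k+1}=(D^k\otimes\mathrm{id})\circ D$; and $D^{-k}=(D^k)^{-1}$. **Theorem.** (1) Let $M$ be an essential correspondence over the unital $C^*$-algebra $A$, let $\{m_j:j\ge 0\}$ be a finite or countably infinite Parseval frame for $M$ with $\langle m_0,m_0\rangle=1$, and let $(X,D,\phi)$ be a scaling function for $m_0$. Form $M_\infty$ with respect to $m_0$. There are a unique isomorphism $R:M_\infty\to M_\infty\otimes_AM$ and a unique inner-product preserving module map $Q:M_\infty\to X$ such that $R\circ\iota^{k+1}=\iota^k\otimes\mathrm{id}$ for $k\ge 0$, $Q(\iota^0(1))=\phi$ and $D\circ Q=(Q\otimes\mathrm{id})\circ R$. Moreover $$\{\phi\}\cup\big\{D^{-k}(\phi\otimes m_{j_1}\otimes\cdots\otimes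 m_{j_k}) : k\ge 1,\ j_l\ge 0,\ j_1>0\big\}$$ is a Parseval frame for $Q(M_\infty)$. If $\{m_j\}$ is orthonormal, it is an orthonormal basis for $Q(M_\infty)$. (2) Let $C$ be a compact Hausdorff space and $\sigma:C\to C$ a surjective local homeomorphism. Let $A=C(C)$, $\alpha(f)=f\circ\sigma$ and $L(f)(c)=|\sigma^{-1}(c)|^{-1}\sum_{\sigma(d)=c}f(d)$. Let $M_L$ be the correspondence obtained by completing $C(C)$ with the right action $m\cdot a=m\,\alpha(a)$, the left action by multiplication and the inner product $\langle m,n\rangle=L(m^*n)$. (The underlying space of $M_L$ is $C(C)$.) Let $m_j\in C(C)$ $(j\ge0)$ be a finite or countably infinite family that is a Parseval frame for $M_L$, with $\langle m_0,m_0\rangle=1$ in $M_L$. Let $X$ be a Hilbert $C(C)$-module, let $\phi\in X$ satisfy $\langle\phi,\phi\rangle=1$, and let $D:X\to X$ be a linear isomorphism such that $$D(x\cdot f)=(Dx)\cdot\alpha(f),\qquad L(\langle Dx,Dy\rangle)=\langle x,y\rangle,\qquad D\phi=\phi\cdot m_0 .$$ Write $(M_L)_\infty$ for the module $M_\infty$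 formed from $M=M_L$ and $m=m_0$. There are a unique linear isomorphism $R$ of $(M_L)_\infty$ onto itself and a unique inner-product preserving module map $Q:(M_L)_\infty\to X$ such that $R(x\cdot f)=(Rx)\cdot\alpha(f)$, $L(\langle Rx,Ry\rangle)=\langle x,y\rangle$, $R(\iota^{k+1}(z\otimes a))=\iota^k(z)\cdot a$ for $k\ge 0$, $z\in M_L^{\otimes k}$ and $a\in C(C)$, $Q(\iota^0(1))=\phi$ and $D\circ Q=Q\circ R$. Moreover $$\{\phi\}\cup\Big\{D^{-k}\Big(\phi\cdot\prod_{l=1}^k\alpha^{l-1}(m_{j_l})\Big) : k\ge 1,\ j_l\ge 0,\ j_1>0\Big\}$$ is a Parseval frame for $Q((M_L)_\infty)$. If $\{m_j\}$ is orthonormal in $M_L$, it is an orthonormal basis for $Q((M_L)_\infty)$. -/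

import Mathlib

open scoped RightActions TensorProduct ComplexOrder

universe u

set_option linter.unusedSectionVars false

noncomputable section

/-- A (complete) right Hilbert `A`-module. The inner product is `A`-valued, conjugate linear in the
first variable, linear in the second, and `⟨x, y · a⟩ = ⟨x, y⟩ a`; the right action is encoded as an
action of `Aᵐᵒᵖ`, so that `x <• a` is `x · a`. Definiteness of the inner product is part of
`norm_eq`. -/
structure RightHilbertModule (A : Type u) [CStarAlgebra A] [PartialOrder A] where
  carrier : Type u
  [normedAddCommGroup : NormedAddCommGroup carrier]
  [normedSpace : NormedSpace ℂ carrier]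
  [completeSpace : CompleteSpace carrier]
  [module : Module Aᵐᵒᵖ carrier]
  [isScalarTower : IsScalarTower ℂ Aᵐᵒᵖ carrier]
  inner : carrier → carrier → A
  inner_add_right : ∀ x y z, inner x (y + z) = inner x y + inner x z
  inner_smul_right : ∀ x y (a : A), inner x (y <• a) = inner x y * a
  star_inner : ∀ x y, star (inner x y) = inner y x
  inner_self_nonneg : ∀ x, 0 ≤ inner x x
  norm_eq : ∀ x, ‖x‖ = √‖inner x x‖

instance (A : Type u) [CStarAlgebra A] [PartialOrder A] :
    CoeSort (RightHilbertModule A) (Type u) := ⟨RightHilbertModule.carrier⟩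

attribute [instance] RightHilbertModule.normedAddCommGroup RightHilbertModule.normedSpace
  RightHilbertModule.completeSpace RightHilbertModule.module RightHilbertModule.isScalarTower

/-- A correspondence over the unital C*-algebra `A` that is essential as a left module: a right
Hilbert `A`-module with a unital left action of `A` by adjointable operators, `a ↦ (x ↦ a • x)`
being a `*`-homomorphism. -/
structure CStarCorrespondence (A : Type u) [CStarAlgebra A] [PartialOrder A] extends
    RightHilbertModule A where
  [leftModule : Module A carrier]
  [leftIsScalarTower : IsScalarTower ℂ A carrier]
  inner_left_smul : ∀ (a : A) x y, inner (a • x) y = inner x (star a • y)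

instance (A : Type u) [CStarAlgebra A] [PartialOrder A] :
    CoeSort (CStarCorrespondence A) (Type u) := ⟨fun M => M.carrier⟩

attribute [instance] CStarCorrespondence.leftModule CStarCorrespondence.leftIsScalarTower

/-- An inner-product preserving map of Hilbert modules. -/
structure InnerMap {A : Type u} [CStarAlgebra A] [PartialOrder A]
    (X Y : RightHilbertModule A) extends X →ₗ[Aᵐᵒᵖ] Y where
  inner_map : ∀ x y, Y.inner (toFun x) (toFun y) = X.inner x y

/-- An isomorphism of Hilbert modules. -/
structure InnerEquiv {A : Type u} [CStarAlgebra A] [PartialOrder A]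
    (X Y : RightHilbertModule A) extends X ≃ₗ[Aᵐᵒᵖ] Y where
  inner_map : ∀ x y, Y.inner (toFun x) (toFun y) = X.inner x y

section PreHilbert

/-- An `A`-valued semi-inner product on a right `A`-module. -/
structure PreHilbertModule (A E : Type u) [CStarAlgebra A] [PartialOrder A] [AddCommGroup E]
    [Module ℂ E] [Module Aᵐᵒᵖ E] [IsScalarTower ℂ Aᵐᵒᵖ E] where
  inner : E → E → A
  inner_add_right : ∀ x y z, inner x (y + z) = inner x y + inner x z
  inner_smul_right : ∀ x y (a : A), inner x (y <• a) = inner x y * a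
  star_inner : ∀ x y, star (inner x y) = inner y x
  inner_self_nonneg : ∀ x, 0 ≤ inner x x

namespace PreHilbertModule

variable {A E : Type u} [CStarAlgebra A] [PartialOrder A] [AddCommGroup E]
  [Module ℂ E] [Module Aᵐᵒᵖ E] [IsScalarTower ℂ Aᵐᵒᵖ E] (P : PreHilbertModule A E)

lemma inner_add_left (x y z : E) : P.inner (x + y) z = P.inner x z + P.inner y z := by
  rw [← P.star_inner z, P.inner_add_right, star_add, P.star_inner, P.star_inner]

lemma inner_smul_left (x y : E) (a : A) : P.inner (x <• a) y = star a * P.inner x y := by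
  rw [← P.star_inner y, P.inner_smul_right, star_mul, P.star_inner]

lemma complex_smul_eq (c : ℂ) (x : E) : c • x = x <• (c • (1 : A)) := by
  rw [MulOpposite.op_smul, smul_assoc, MulOpposite.op_one, one_smul]

lemma inner_csmul_right (x y : E) (c : ℂ) : P.inner x (c • y) = c • P.inner x y := by
  rw [complex_smul_eq (A := A), P.inner_smul_right, mul_smul_comm, mul_one]

lemma inner_csmul_left (x y : E) (c : ℂ) : P.inner (c • x) y = star c • P.inner x y := by
  rw [← P.star_inner y, P.inner_csmul_right, star_smul, P.star_inner]

lemma inner_zero_right (x : E) : P.inner x 0 = 0 := by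
  simpa using P.inner_csmul_right x 0 0

lemma inner_zero_left (x : E) : P.inner 0 x = 0 := by
  simpa using P.inner_csmul_left 0 x 0

lemma inner_neg_right (x y : E) : P.inner x (-y) = -P.inner x y := by
  simpa using P.inner_csmul_right x y (-1)

lemma inner_neg_left (x y : E) : P.inner (-x) y = -P.inner x y := by
  simpa using P.inner_csmul_left x y (-1)

lemma inner_sub_right (x y z : E) : P.inner x (y - z) = P.inner x y - P.inner x z := by
  rw [sub_eq_add_neg, P.inner_add_right, P.inner_neg_right, sub_eq_add_neg]

lemma inner_sub_left (x y z : E) : P.inner (x - y) z = P.inner x z - P.inner y z := by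
  rw [sub_eq_add_neg, P.inner_add_left, P.inner_neg_left, sub_eq_add_neg]

lemma inner_sum_right {ι : Type*} (s : Finset ι) (x : E) (f : ι → E) :
    P.inner x (∑ i ∈ s, f i) = ∑ i ∈ s, P.inner x (f i) := by
  classical
  induction s using Finset.induction_on with
  | empty => simp [P.inner_zero_right]
  | insert i s hi ih => rw [Finset.sum_insert hi, Finset.sum_insert hi, P.inner_add_right, ih]

lemma inner_sum_left {ι : Type*} (s : Finset ι) (x : E) (f : ι → E) :
    P.inner (∑ i ∈ s, f i) x = ∑ i ∈ s, P.inner (f i) x := by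
  rw [← P.star_inner, P.inner_sum_right, star_sum]
  simp only [P.star_inner]

variable [StarOrderedRing A]

lemma norm_inner_sq_le (x y : E) : ‖P.inner x y‖ ^ 2 ≤ ‖P.inner x x‖ * ‖P.inner y y‖ := by
  have key : ∀ t : ℝ, ‖P.inner x x‖ < t → ‖P.inner x y‖ ^ 2 ≤ t * ‖P.inner y y‖ := by
    intro t ht
    have ht0 : 0 < t := (norm_nonneg _).trans_lt ht
    set a := P.inner x y with ha
    have h0 := P.inner_self_nonneg (x <• a - (t : ℂ) • y)
    have hyx : P.inner y x = star a := by rw [ha, P.star_inner]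
    have e1 : P.inner (x <• a - (t : ℂ) • y) (x <• a - (t : ℂ) • y)
        = star a * P.inner x x * a - (2 * t) • (star a * a) + (t * t) • P.inner y y := by
      simp only [inner_sub_left, inner_sub_right, inner_smul_left, inner_smul_right,
        inner_csmul_left, inner_csmul_right, hyx, ← ha, Complex.star_def, Complex.conj_ofReal,
        sub_mul, smul_sub, smul_mul_assoc, mul_assoc]
      simp only [Complex.coe_smul, two_mul, add_smul, mul_smul]
      abel
    have e2 : star a * P.inner x x * a ≤ t • (star a * a) := by
      have hs : IsSelfAdjoint (P.inner x x) := P.star_inner x x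
      refine (CStarAlgebra.star_left_conjugate_le_norm_smul (a := a) hs).trans ?_
      exact smul_le_smul_of_nonneg_right ht.le (star_mul_self_nonneg a)
    have e3 : t • (star a * a) ≤ (t * t) • P.inner y y := by
      rw [e1] at h0
      have : (0 : A) ≤ t • (star a * a) - (2 * t) • (star a * a) + (t * t) • P.inner y y := by
        refine h0.trans ?_
        gcongr
      have h3 : t • (star a * a) - (2 * t) • (star a * a) = - (t • (star a * a)) := by
        rw [← sub_smul, ← neg_smul]; congr 1; ring
      rw [h3, neg_add_eq_sub, sub_nonneg] at this
      exact this
    have e4 := CStarAlgebra.norm_le_norm_of_nonneg_of_le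
      (smul_nonneg ht0.le (star_mul_self_nonneg a)) e3
    rw [norm_smul, norm_smul, CStarRing.norm_star_mul_self, Real.norm_of_nonneg ht0.le,
      Real.norm_of_nonneg (by positivity)] at e4
    have : t * ‖a‖ ^ 2 ≤ t * (t * ‖P.inner y y‖) := by nlinarith
    exact le_of_mul_le_mul_left this ht0
  have hc : Filter.Tendsto (fun t : ℝ => t * ‖P.inner y y‖)
      (nhdsWithin ‖P.inner x x‖ (Set.Ioi ‖P.inner x x‖)) (nhds (‖P.inner x x‖ * ‖P.inner y y‖)) :=
    ((continuous_id.mul continuous_const).tendsto _).mono_left nhdsWithin_le_nhds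
  exact ge_of_tendsto hc (Filter.eventually_of_mem self_mem_nhdsWithin key)

lemma norm_inner_le (x y : E) : ‖P.inner x y‖ ≤ √‖P.inner x x‖ * √‖P.inner y y‖ := by
  rw [← Real.sqrt_mul (norm_nonneg _)]
  exact Real.le_sqrt_of_sq_le (P.norm_inner_sq_le x y)

/-- The underlying space of a pre-Hilbert module, seminormed by `‖x‖ = ‖⟨x, x⟩‖^{1/2}`. -/
def Space (_ : PreHilbertModule A E) : Type u := E

instance : AddCommGroup P.Space := inferInstanceAs (AddCommGroup E)
instance : Module ℂ P.Space := inferInstanceAs (Module ℂ E)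
instance : Module Aᵐᵒᵖ P.Space := inferInstanceAs (Module Aᵐᵒᵖ E)
instance : IsScalarTower ℂ Aᵐᵒᵖ P.Space := inferInstanceAs (IsScalarTower ℂ Aᵐᵒᵖ E)

/-- The semi-inner product, on the seminormed space. -/
def onSpace : PreHilbertModule A P.Space where
  inner := P.inner
  inner_add_right := P.inner_add_right
  inner_smul_right := P.inner_smul_right
  star_inner := P.star_inner
  inner_self_nonneg := P.inner_self_nonneg

/-- The inner product on the underlying space. -/
def ip (x y : P.Space) : A := P.onSpace.inner x y

instance : Norm P.Space := ⟨fun x => √‖P.ip x x‖⟩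

lemma norm_def (x : P.Space) : ‖x‖ = √‖P.ip x x‖ := rfl

lemma norm_ip_le (x y : P.Space) : ‖P.ip x y‖ ≤ ‖x‖ * ‖y‖ := P.norm_inner_le x y

lemma norm_sq_eq (x : P.Space) : ‖x‖ ^ 2 = ‖P.ip x x‖ := Real.sq_sqrt (norm_nonneg _)

lemma core : SeminormedSpace.Core ℂ P.Space where
  norm_nonneg _ := Real.sqrt_nonneg _
  norm_smul c x := by
    rw [norm_def, norm_def, ip, ip, P.onSpace.inner_csmul_left, P.onSpace.inner_csmul_right, smul_smul, norm_smul,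
      norm_mul, norm_star, Real.sqrt_mul (by positivity), Real.sqrt_mul_self (norm_nonneg _)]
  norm_triangle x y := by
    have hx : 0 ≤ ‖x‖ := Real.sqrt_nonneg _
    have hy : 0 ≤ ‖y‖ := Real.sqrt_nonneg _
    refine Real.sqrt_le_iff.2 ⟨by positivity, ?_⟩
    have e : P.ip (x + y) (x + y) = P.ip x x + P.ip x y + (P.ip y x + P.ip y y) := by
      unfold ip
      rw [P.onSpace.inner_add_left, P.onSpace.inner_add_right, P.onSpace.inner_add_right]
    rw [e]
    have h1 := P.norm_sq_eq x
    have h2 := P.norm_sq_eq y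
    have h3 := P.norm_ip_le x y
    have h4 := P.norm_ip_le y x
    have h5 := norm_add_le (P.ip x x + P.ip x y) (P.ip y x + P.ip y y)
    have h6 := norm_add_le (P.ip x x) (P.ip x y)
    have h7 := norm_add_le (P.ip y x) (P.ip y y)
    nlinarith

instance : SeminormedAddCommGroup P.Space := SeminormedAddCommGroup.ofCore P.core
instance : NormedSpace ℂ P.Space where
  norm_smul_le c x := (P.core.norm_smul c x).le

lemma norm_op_smul_le (a : A) (x : P.Space) : ‖x <• a‖ ≤ ‖a‖ * ‖x‖ := by
  have h : ‖x <• a‖ ^ 2 ≤ (‖a‖ * ‖x‖) ^ 2 := by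
    have e : P.ip (x <• a) (x <• a) = star a * (P.ip x x * a) := by
      unfold ip
      rw [P.onSpace.inner_smul_left, P.onSpace.inner_smul_right]
    rw [P.norm_sq_eq, e, mul_pow, P.norm_sq_eq]
    refine (norm_mul_le _ _).trans ?_
    rw [norm_star]
    have := norm_mul_le (P.ip x x) a
    nlinarith [norm_nonneg a]
  exact le_of_sq_le_sq h (by positivity)

lemma uniformContinuousConstSMul_of_bound {R : Type*} [Monoid R] [DistribMulAction R P.Space]
    (h : ∀ r : R, ∃ C : ℝ, ∀ x : P.Space, ‖r • x‖ ≤ C * ‖x‖) :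
    UniformContinuousConstSMul R P.Space where
  uniformContinuous_const_smul r := by
    obtain ⟨C, hC⟩ := h r
    exact (AddMonoidHomClass.lipschitz_of_bound (DistribSMul.toAddMonoidHom P.Space r) C
      hC).uniformContinuous

instance : UniformContinuousConstSMul Aᵐᵒᵖ P.Space :=
  P.uniformContinuousConstSMul_of_bound fun r => ⟨‖r.unop‖, fun x => P.norm_op_smul_le r.unop x⟩

open UniformSpace

lemma continuous_ip : Continuous fun p : P.Space × P.Space => P.ip p.1 p.2 := by
  rw [continuous_iff_continuousAt]
  rintro ⟨x, y⟩
  rw [ContinuousAt, tendsto_iff_norm_sub_tendsto_zero]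
  have hb : ∀ p : P.Space × P.Space, ‖P.ip p.1 p.2 - P.ip x y‖ ≤
      ‖p.1 - x‖ * ‖p.2‖ + ‖x‖ * ‖p.2 - y‖ := by
    intro p
    have e : P.ip p.1 p.2 - P.ip x y = P.ip (p.1 - x) p.2 + P.ip x (p.2 - y) := by
      unfold ip
      rw [P.onSpace.inner_sub_left, P.onSpace.inner_sub_right]
      abel
    rw [e]
    exact (norm_add_le _ _).trans (add_le_add (P.norm_ip_le _ _) (P.norm_ip_le _ _))
  have hc : Filter.Tendsto (fun p : P.Space × P.Space => ‖p.1 - x‖ * ‖p.2‖ + ‖x‖ * ‖p.2 - y‖)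
      (nhds (x, y)) (nhds (‖x - x‖ * ‖y‖ + ‖x‖ * ‖y - y‖)) := by
    have : Continuous (fun p : P.Space × P.Space => ‖p.1 - x‖ * ‖p.2‖ + ‖x‖ * ‖p.2 - y‖) := by
      fun_prop
    exact this.tendsto (x, y)
  simp only [sub_self, norm_zero, zero_mul, mul_zero, add_zero] at hc
  exact squeeze_zero (fun _ => norm_nonneg _) hb hc

/-- The extension of the inner product to the completion by continuity. -/
def cip (x y : Completion P.Space) : A :=
  (Completion.isDenseInducing_coe.prodMap Completion.isDenseInducing_coe).extend
    (fun p : P.Space × P.Space => P.ip p.1 p.2) (x, y)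

@[simp] lemma cip_coe (x y : P.Space) :
    P.cip (x : Completion P.Space) (y : Completion P.Space) = P.ip x y :=
  (Completion.isDenseInducing_coe.prodMap Completion.isDenseInducing_coe).extend_eq
    P.continuous_ip (x, y)

lemma continuous_cip :
    Continuous fun p : Completion P.Space × Completion P.Space => P.cip p.1 p.2 := by
  let ip' : P.Space →+ P.Space →+ A :=
    AddMonoidHom.mk' (fun x => AddMonoidHom.mk' (fun y => P.ip x y) (P.inner_add_right x))
      (fun x y => by ext z; exact P.inner_add_left x y z)
  have h : Continuous fun p : P.Space × P.Space => ip' p.1 p.2 := P.continuous_ip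
  exact (Completion.isDenseInducing_toCompl P.Space).extend_Z_bilin
    (Completion.isDenseInducing_toCompl P.Space) h

lemma _root_.Continuous.cip {α : Type*} [TopologicalSpace α] {f g : α → Completion P.Space}
    (hf : Continuous f) (hg : Continuous g) : Continuous fun x => P.cip (f x) (g x) :=
  P.continuous_cip.comp (hf.prodMk hg)

lemma cip_add_right (x y z : Completion P.Space) : P.cip x (y + z) = P.cip x y + P.cip x z := by
  refine Completion.induction_on₃ x y z (isClosed_eq ?_ ?_) fun x y z => ?_
  · exact Continuous.cip P continuous_fst (continuous_snd.fst.add continuous_snd.snd)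
  · exact (Continuous.cip P continuous_fst continuous_snd.fst).add
      (Continuous.cip P continuous_fst continuous_snd.snd)
  · rw [← Completion.coe_add, cip_coe, cip_coe, cip_coe]
    exact P.inner_add_right x y z

lemma cip_smul_right (x y : Completion P.Space) (a : A) : P.cip x (y <• a) = P.cip x y * a := by
  refine Completion.induction_on₂ x y (isClosed_eq ?_ ?_) fun x y => ?_
  · exact Continuous.cip P continuous_fst
      ((continuous_const_smul (MulOpposite.op a)).comp continuous_snd)
  · exact (Continuous.cip P continuous_fst continuous_snd).mul continuous_const
  · rw [← Completion.coe_smul, cip_coe, cip_coe]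
    exact P.inner_smul_right x y a

lemma star_cip (x y : Completion P.Space) : star (P.cip x y) = P.cip y x := by
  refine Completion.induction_on₂ x y (isClosed_eq ?_ ?_) fun x y => ?_
  · exact (Continuous.cip P continuous_fst continuous_snd).star
  · exact Continuous.cip P continuous_snd continuous_fst
  · rw [cip_coe, cip_coe]
    exact P.star_inner x y

lemma cip_self_nonneg (x : Completion P.Space) : 0 ≤ P.cip x x := by
  refine Completion.induction_on x (isClosed_le continuous_const ?_) fun x => ?_
  · exact Continuous.cip P continuous_id continuous_id
  · rw [cip_coe]
    exact P.inner_self_nonneg x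

lemma norm_eq_cip (x : Completion P.Space) : ‖x‖ = √‖P.cip x x‖ := by
  refine Completion.induction_on x (isClosed_eq continuous_norm ?_) fun x => ?_
  · exact (Continuous.cip P continuous_id continuous_id).norm.sqrt
  · rw [Completion.norm_coe, cip_coe, norm_def]

/-- The Hilbert module obtained from a pre-Hilbert module by completing (which also divides out the
vectors of length zero). -/
def completion : RightHilbertModule A where
  carrier := Completion P.Space
  inner := P.cip
  inner_add_right := P.cip_add_right
  inner_smul_right := P.cip_smul_right
  star_inner := P.star_cip
  inner_self_nonneg := P.cip_self_nonneg
  norm_eq := P.norm_eq_cip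

/-- The canonical map of a pre-Hilbert module into its completion. -/
def of : E →ₗ[Aᵐᵒᵖ] P.completion where
  toFun x := ((show P.Space from x : P.Space) : Completion P.Space)
  map_add' _ _ := Completion.coe_add _ _
  map_smul' a x := Completion.coe_smul a (show P.Space from x)

lemma inner_of (x y : E) : P.completion.inner (P.of x) (P.of y) = P.inner x y := P.cip_coe x y

end PreHilbertModule

end PreHilbert

namespace RightHilbertModule

variable {A : Type u} [CStarAlgebra A] [PartialOrder A]

/-- The inner product of a Hilbert module, regarded as a semi-inner product. -/
def pre (X : RightHilbertModule A) : PreHilbertModule A X where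
  inner := X.inner
  inner_add_right := X.inner_add_right
  inner_smul_right := X.inner_smul_right
  star_inner := X.star_inner
  inner_self_nonneg := X.inner_self_nonneg

/-- The free rank-one Hilbert module `A_A`, with `⟨a, b⟩ = a* b`. -/
def self (A : Type u) [CStarAlgebra A] [PartialOrder A] [StarOrderedRing A] :
    RightHilbertModule A where
  carrier := A
  inner a b := star a * b
  inner_add_right _ _ _ := mul_add _ _ _
  inner_smul_right _ _ _ := (mul_assoc _ _ _).symm
  star_inner _ _ := by rw [star_mul, star_star]
  inner_self_nonneg _ := star_mul_self_nonneg _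
  norm_eq x := by rw [CStarRing.norm_star_mul_self, Real.sqrt_mul_self (norm_nonneg _)]

lemma exists_posPart_negPart {B : Type*} [NonUnitalCStarAlgebra B] [PartialOrder B]
    [StarOrderedRing B] (G : B) (hG : IsSelfAdjoint G) :
    ∃ N R T : B, G = star T * T - N ∧ star N = N ∧ star T * T * N = 0 ∧ N = star R * R := by
  obtain ⟨T, hT⟩ := CStarAlgebra.nonneg_iff_eq_star_mul_self.1 (CFC.posPart_nonneg G)
  obtain ⟨R, hR⟩ := CStarAlgebra.nonneg_iff_eq_star_mul_self.1 (CFC.negPart_nonneg G)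
  refine ⟨G⁻, R, T, ?_, (CFC.negPart_nonneg G).isSelfAdjoint, ?_, hR⟩
  · rw [← hT, CFC.posPart_sub_negPart G hG]
  · rw [← hT, CFC.posPart_mul_negPart]

/-- The Gram matrix of a finite family in a Hilbert module is a positive matrix over `A`. -/
lemma exists_gram [StarOrderedRing A] (X : RightHilbertModule A) {ι : Type*} [Fintype ι]
    [DecidableEq ι] (x : ι → X) :
    ∃ B : ι → ι → A, ∀ i j, X.inner (x i) (x j) = ∑ k, star (B k i) * B k j := by
  let G : CStarMatrix ι ι A := CStarMatrix.ofMatrix (Matrix.of fun i j => X.inner (x i) (x j))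
  have hG : IsSelfAdjoint G := by
    ext i j
    exact X.star_inner _ _
  obtain ⟨N, R, T, hGN, hNs, hTN, hR⟩ := exists_posPart_negPart G hG
  have hGN' : G * N = -(N * N) := by
    rw [hGN, sub_mul, hTN, zero_sub]
  have h3 : star N * (G * N) = - (star (R * N) * (R * N)) := by
    rw [hGN', hNs, star_mul, hNs, mul_assoc N (star R), ← mul_assoc (star R), ← hR, mul_neg]
  have hdiag : ∀ k, 0 ≤ (star N * (G * N)) k k := by
    intro k
    have e : (star N * (G * N)) k k
        = X.inner (∑ i, x i <• (N i k)) (∑ j, x j <• (N j k)) := by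
      change _ = X.pre.inner _ _
      simp only [PreHilbertModule.inner_sum_right, PreHilbertModule.inner_sum_left,
        PreHilbertModule.inner_smul_left, PreHilbertModule.inner_smul_right, Finset.sum_mul]
      rw [Finset.sum_comm]
      change ∑ i, star (N i k) * (∑ j, X.inner (x i) (x j) * N j k) = _
      refine Finset.sum_congr rfl fun i _ => ?_
      rw [Finset.mul_sum]
      exact Finset.sum_congr rfl fun j _ => (mul_assoc _ _ _).symm
    rw [e]
    exact X.inner_self_nonneg _
  have hzero : R * N = 0 := by
    ext l k
    have h1 : (0 : A) ≤ - ∑ l, star ((R * N) l k) * (R * N) l k := by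
      have := hdiag k
      rw [h3] at this
      exact this
    have h2 : ∑ l, star ((R * N) l k) * (R * N) l k = 0 :=
      le_antisymm (neg_nonneg.1 h1) (Finset.sum_nonneg fun l _ => star_mul_self_nonneg _)
    have h4 := (Finset.sum_eq_zero_iff_of_nonneg
      (fun l _ => star_mul_self_nonneg ((R * N) l k))).1 h2 l (Finset.mem_univ _)
    exact CStarRing.star_mul_self_eq_zero_iff _ |>.1 h4
  have hN : N = 0 := by
    refine CStarRing.star_mul_self_eq_zero_iff _ |>.1 ?_
    rw [hNs]
    nth_rw 1 [hR]
    rw [mul_assoc, hzero, mul_zero]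
  rw [hN, sub_zero] at hGN
  exact ⟨T, fun i j => congrArg (fun S : CStarMatrix ι ι A => S i j) hGN⟩

end RightHilbertModule

section InnerMap

variable {A : Type u} [CStarAlgebra A] [PartialOrder A] {X Y Z : RightHilbertModule A}

namespace InnerMap

instance : FunLike (InnerMap X Y) X Y where
  coe f := f.toLinearMap
  coe_injective := by
    rintro ⟨f, hf⟩ ⟨g, hg⟩ h
    congr
    exact DFunLike.coe_injective h

instance : LinearMapClass (InnerMap X Y) Aᵐᵒᵖ X Y where
  map_add f := f.toLinearMap.map_add
  map_smulₛₗ f := f.toLinearMap.map_smul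

@[ext] lemma ext {f g : InnerMap X Y} (h : ∀ x, f x = g x) : f = g := DFunLike.ext _ _ h

lemma inner_apply (f : InnerMap X Y) (x y : X) : Y.inner (f x) (f y) = X.inner x y :=
  f.inner_map x y

lemma map_complex_smul (f : InnerMap X Y) (c : ℂ) (x : X) : f (c • x) = c • f x := by
  rw [PreHilbertModule.complex_smul_eq (A := A) c x, map_smul,
    PreHilbertModule.complex_smul_eq (A := A) c (f x)]

/-- The identity map. -/
def id (X : RightHilbertModule A) : InnerMap X X where
  toLinearMap := LinearMap.id
  inner_map _ _ := rfl

/-- Composition of inner-product preserving maps. -/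
def comp (g : InnerMap Y Z) (f : InnerMap X Y) : InnerMap X Z where
  toLinearMap := g.toLinearMap.comp f.toLinearMap
  inner_map x y := (g.inner_map _ _).trans (f.inner_map x y)

@[simp] lemma id_apply (x : X) : id X x = x := rfl

@[simp] lemma comp_apply (g : InnerMap Y Z) (f : InnerMap X Y) (x : X) :
    g.comp f x = g (f x) := rfl

end InnerMap

namespace InnerEquiv

instance : EquivLike (InnerEquiv X Y) X Y where
  coe f := f.toLinearEquiv
  inv f := f.toLinearEquiv.symm
  left_inv f := f.toLinearEquiv.left_inv
  right_inv f := f.toLinearEquiv.right_inv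
  coe_injective' := by
    rintro ⟨f, hf⟩ ⟨g, hg⟩ h _
    congr
    exact DFunLike.coe_injective h

@[ext] lemma ext {f g : InnerEquiv X Y} (h : ∀ x, f x = g x) : f = g := DFunLike.ext _ _ h

/-- The underlying inner-product preserving map of an isomorphism. -/
def toInnerMap (f : InnerEquiv X Y) : InnerMap X Y where
  toLinearMap := f.toLinearEquiv.toLinearMap
  inner_map := f.inner_map

@[simp] lemma toInnerMap_apply (f : InnerEquiv X Y) (x : X) : f.toInnerMap x = f x := rfl

/-- The identity isomorphism. -/
def refl (X : RightHilbertModule A) : InnerEquiv X X where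
  toLinearEquiv := LinearEquiv.refl _ _
  inner_map _ _ := rfl

/-- The inverse isomorphism. -/
def symm (f : InnerEquiv X Y) : InnerEquiv Y X where
  toLinearEquiv := f.toLinearEquiv.symm
  inner_map x y := by
    have h := f.inner_map (f.toLinearEquiv.symm x) (f.toLinearEquiv.symm y)
    have e : ∀ z, f.toFun (f.toLinearEquiv.symm z) = z := f.toLinearEquiv.apply_symm_apply
    rw [e, e] at h
    exact h.symm

/-- Composition of isomorphisms: `f.trans g = g ∘ f`. -/
def trans (f : InnerEquiv X Y) (g : InnerEquiv Y Z) : InnerEquiv X Z where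
  toLinearEquiv := f.toLinearEquiv.trans g.toLinearEquiv
  inner_map x y := (g.inner_map _ _).trans (f.inner_map x y)

@[simp] lemma refl_apply (x : X) : refl X x = x := rfl

@[simp] lemma trans_apply (f : InnerEquiv X Y) (g : InnerEquiv Y Z) (x : X) :
    f.trans g x = g (f x) := rfl

@[simp] lemma apply_symm_apply (f : InnerEquiv X Y) (y : Y) : f (f.symm y) = y :=
  f.toLinearEquiv.apply_symm_apply y

@[simp] lemma symm_apply_apply (f : InnerEquiv X Y) (x : X) : f.symm (f x) = x :=
  f.toLinearEquiv.symm_apply_apply x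

end InnerEquiv

end InnerMap

namespace PreHilbertModule

open UniformSpace

variable {A E F : Type u} [CStarAlgebra A] [PartialOrder A] [StarOrderedRing A]
  [AddCommGroup E] [Module ℂ E] [Module Aᵐᵒᵖ E] [IsScalarTower ℂ Aᵐᵒᵖ E]
  [AddCommGroup F] [Module ℂ F] [Module Aᵐᵒᵖ F] [IsScalarTower ℂ Aᵐᵒᵖ F]
  {P : PreHilbertModule A E} {Q : PreHilbertModule A F}

/-- A module map of pre-Hilbert modules that preserves the inner products, as a map of the
seminormed spaces. -/
def spaceMap (f : E →ₗ[Aᵐᵒᵖ] F) : P.Space →ₗ[Aᵐᵒᵖ] Q.Space := f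

lemma uniformContinuous_spaceMap (f : E →ₗ[Aᵐᵒᵖ] F)
    (hf : ∀ x y, Q.inner (f x) (f y) = P.inner x y) :
    UniformContinuous (spaceMap f : P.Space →ₗ[Aᵐᵒᵖ] Q.Space) := by
  refine (AddMonoidHomClass.lipschitz_of_bound (spaceMap f : P.Space →ₗ[Aᵐᵒᵖ] Q.Space) 1
    fun x => ?_).uniformContinuous
  have e : Q.ip (spaceMap f x) (spaceMap f x) = P.ip x x := hf x x
  rw [one_mul, norm_def, norm_def, e]

section

variable (f : E →ₗ[Aᵐᵒᵖ] F)

lemma map_spaceMap_add (hu : UniformContinuous (spaceMap f : P.Space →ₗ[Aᵐᵒᵖ] Q.Space))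
    (x y : Completion P.Space) :
    Completion.map (spaceMap f : P.Space →ₗ[Aᵐᵒᵖ] Q.Space) (x + y) =
      Completion.map (spaceMap f : P.Space →ₗ[Aᵐᵒᵖ] Q.Space) x +
      Completion.map (spaceMap f : P.Space →ₗ[Aᵐᵒᵖ] Q.Space) y := by
  have hc : Continuous (Completion.map (spaceMap f : P.Space →ₗ[Aᵐᵒᵖ] Q.Space)) :=
    Completion.continuous_map
  refine Completion.induction_on₂ x y (isClosed_eq ?_ ?_) fun x y => ?_
  · exact hc.comp (continuous_fst.add continuous_snd)
  · exact (hc.comp continuous_fst).add (hc.comp continuous_snd)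
  · rw [← Completion.coe_add, Completion.map_coe hu, Completion.map_coe hu,
      Completion.map_coe hu, map_add, Completion.coe_add]

lemma map_spaceMap_smul (hu : UniformContinuous (spaceMap f : P.Space →ₗ[Aᵐᵒᵖ] Q.Space))
    (a : Aᵐᵒᵖ) (x : Completion P.Space) :
    Completion.map (spaceMap f : P.Space →ₗ[Aᵐᵒᵖ] Q.Space) (a • x) =
      a • Completion.map (spaceMap f : P.Space →ₗ[Aᵐᵒᵖ] Q.Space) x := by
  refine Completion.induction_on x (isClosed_eq ?_ ?_) fun x => ?_
  · exact Completion.continuous_map.comp (continuous_const_smul a)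
  · exact (continuous_const_smul a).comp Completion.continuous_map
  · rw [← Completion.coe_smul, Completion.map_coe hu, Completion.map_coe hu, map_smul,
      Completion.coe_smul]

lemma cip_map_spaceMap (hf : ∀ x y, Q.inner (f x) (f y) = P.inner x y)
    (hu : UniformContinuous (spaceMap f : P.Space →ₗ[Aᵐᵒᵖ] Q.Space))
    (x y : Completion P.Space) :
    Q.cip (Completion.map (spaceMap f : P.Space →ₗ[Aᵐᵒᵖ] Q.Space) x)
      (Completion.map (spaceMap f : P.Space →ₗ[Aᵐᵒᵖ] Q.Space) y) = P.cip x y := by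
  refine Completion.induction_on₂ x y (isClosed_eq ?_ ?_) fun x y => ?_
  · exact Continuous.cip Q (Completion.continuous_map.comp continuous_fst)
      (Completion.continuous_map.comp continuous_snd)
  · exact Continuous.cip P continuous_fst continuous_snd
  · rw [Completion.map_coe hu, Completion.map_coe hu, cip_coe, cip_coe]
    exact hf x y

end

/-- The extension to the completions of an inner-product preserving module map. -/
def completionMap (f : E →ₗ[Aᵐᵒᵖ] F) (hf : ∀ x y, Q.inner (f x) (f y) = P.inner x y) :
    InnerMap P.completion Q.completion where
  toFun := Completion.map (spaceMap f : P.Space →ₗ[Aᵐᵒᵖ] Q.Space)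
  map_add' := map_spaceMap_add f (uniformContinuous_spaceMap f hf)
  map_smul' := map_spaceMap_smul f (uniformContinuous_spaceMap f hf)
  inner_map := cip_map_spaceMap f hf (uniformContinuous_spaceMap f hf)

lemma completionMap_of (f : E →ₗ[Aᵐᵒᵖ] F) (hf : ∀ x y, Q.inner (f x) (f y) = P.inner x y)
    (x : E) : completionMap f hf (P.of x) = Q.of (f x) :=
  Completion.map_coe (uniformContinuous_spaceMap (P := P) (Q := Q) f hf) x

lemma completion_ext {Y : RightHilbertModule A} {f g : InnerMap P.completion Y}
    (h : ∀ x, f (P.of x) = g (P.of x)) : f = g := by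
  have hcont : ∀ f : InnerMap P.completion Y, Continuous (f : P.completion → Y) := fun f =>
    (AddMonoidHomClass.lipschitz_of_bound f 1 fun x => by
      rw [one_mul, Y.norm_eq, P.completion.norm_eq, f.inner_apply]).continuous
  have hcl : IsClosed {x : Completion P.Space | (f : P.completion → Y) x = g x} :=
    isClosed_eq (hcont f) (hcont g)
  exact InnerMap.ext fun x => Completion.induction_on (α := P.Space) x hcl h

end PreHilbertModule

section Tensor

variable {A : Type u} [CStarAlgebra A] [PartialOrder A]

namespace CStarCorrespondence

lemma inner_right_smul (M : CStarCorrespondence A) (a : A) (x y : M) :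
    M.inner x (a • y) = M.inner (star a • x) y := by
  rw [M.inner_left_smul, star_star]

end CStarCorrespondence

namespace RightHilbertModule

variable (X : RightHilbertModule A) (M : CStarCorrespondence A)

/-- For fixed `m` and `x`, the functional `n ⊗ y ↦ ⟨m, ⟨x, y⟩ • n⟩`. -/
def tensorFunctional (m : M) (x : X) : M ⊗[ℂ] X →ₗ[ℂ] A :=
  TensorProduct.lift <| LinearMap.mk₂ ℂ (fun (n : M) (y : X) => M.inner m (X.inner x y • n))
    (fun n n' y => by rw [smul_add, M.inner_add_right])
    (fun c n y => by
      rw [smul_comm]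
      exact M.pre.inner_csmul_right _ _ _)
    (fun n y y' => by rw [X.inner_add_right, add_smul, M.inner_add_right])
    (fun c n y => by
      have h : X.inner x (c • y) = c • X.inner x y := X.pre.inner_csmul_right _ _ _
      rw [h, smul_assoc]
      exact M.pre.inner_csmul_right _ _ _)

@[simp] lemma tensorFunctional_tmul (m n : M) (x y : X) :
    X.tensorFunctional M m x (n ⊗ₜ y) = M.inner m (X.inner x y • n) := rfl

/-- The sesquilinear form `(m ⊗ x, n ⊗ y) ↦ ⟨m, ⟨x, y⟩ • n⟩`. -/
def tensorForm : M ⊗[ℂ] X →ₗ⋆[ℂ] M ⊗[ℂ] X →ₗ[ℂ] A :=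
  TensorProduct.lift <| LinearMap.mk₂'ₛₗ (starRingEnd ℂ) (starRingEnd ℂ)
    (fun (m : M) (x : X) => X.tensorFunctional M m x)
    (fun m m' x => TensorProduct.ext' fun n y => M.pre.inner_add_left _ _ _)
    (fun c m x => TensorProduct.ext' fun n y => M.pre.inner_csmul_left _ _ _)
    (fun m x x' => TensorProduct.ext' fun n y => by
      have h : X.inner (x + x') y = X.inner x y + X.inner x' y := X.pre.inner_add_left _ _ _
      rw [LinearMap.add_apply, tensorFunctional_tmul, tensorFunctional_tmul, tensorFunctional_tmul,
        h, add_smul, M.inner_add_right])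
    (fun c m x => TensorProduct.ext' fun n y => by
      have h : X.inner (c • x) y = star c • X.inner x y := X.pre.inner_csmul_left _ _ _
      rw [LinearMap.smul_apply, tensorFunctional_tmul, tensorFunctional_tmul, h, smul_assoc]
      exact M.pre.inner_csmul_right _ _ _)

@[simp] lemma tensorForm_tmul (m n : M) (x y : X) :
    X.tensorForm M (m ⊗ₜ x) (n ⊗ₜ y) = M.inner m (X.inner x y • n) := rfl

lemma tensorForm_smul_right (z w : M ⊗[ℂ] X) (a : A) :
    X.tensorForm M z (w <• a) = X.tensorForm M z w * a := by
  induction z using TensorProduct.induction_on with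
  | zero => simp
  | add z z' hz hz' => rw [map_add, LinearMap.add_apply, LinearMap.add_apply, hz, hz', add_mul]
  | tmul m x =>
    induction w using TensorProduct.induction_on with
    | zero => simp
    | add w w' hw hw' => rw [smul_add, map_add, map_add, hw, hw', add_mul]
    | tmul n y =>
      rw [TensorProduct.smul_tmul', tensorForm_tmul, tensorForm_tmul, M.inner_right_smul,
        M.inner_smul_right, M.inner_right_smul]

lemma star_tensorForm (z w : M ⊗[ℂ] X) :
    star (X.tensorForm M z w) = X.tensorForm M w z := by
  induction z using TensorProduct.induction_on with
  | zero => simp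
  | add z z' hz hz' => rw [map_add, LinearMap.add_apply, star_add, map_add, hz, hz']
  | tmul m x =>
    induction w using TensorProduct.induction_on with
    | zero => simp
    | add w w' hw hw' => rw [map_add, map_add, LinearMap.add_apply, star_add, hw, hw']
    | tmul n y =>
      rw [tensorForm_tmul, tensorForm_tmul, M.star_inner, M.inner_left_smul, X.star_inner]

variable [StarOrderedRing A]

lemma tensorForm_self_nonneg (z : M ⊗[ℂ] X) : 0 ≤ X.tensorForm M z z := by
  classical
  obtain ⟨S, hS⟩ := TensorProduct.exists_finset z
  obtain ⟨B, hB⟩ := X.exists_gram (fun i : S => i.1.2)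
  have e : X.tensorForm M z z = ∑ k : S, M.inner (∑ i : S, B k i • i.1.1)
      (∑ j : S, B k j • j.1.1) := by
    have hr : ∀ k : S, M.inner (∑ i : S, B k i • i.1.1) (∑ j : S, B k j • j.1.1)
        = ∑ i : S, ∑ j : S, M.inner i.1.1 ((star (B k i) * B k j) • j.1.1) := by
      intro k
      change M.pre.inner _ _ = _
      rw [M.pre.inner_sum_left]
      refine Finset.sum_congr rfl fun i _ => ?_
      rw [M.pre.inner_sum_right]
      refine Finset.sum_congr rfl fun j _ => ?_
      change M.inner _ _ = _
      rw [M.inner_left_smul, smul_smul]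
    have hz : z = ∑ i : S, i.1.1 ⊗ₜ[ℂ] i.1.2 := by
      rw [hS, ← Finset.sum_coe_sort S (fun i => i.1 ⊗ₜ[ℂ] i.2)]
    simp only [hr]
    rw [Finset.sum_comm, hz]
    simp only [map_sum, LinearMap.sum_apply]
    rw [Finset.sum_comm]
    refine Finset.sum_congr rfl fun i _ => ?_
    rw [Finset.sum_comm]
    refine Finset.sum_congr rfl fun j _ => ?_
    rw [tensorForm_tmul, hB, Finset.sum_smul]
    exact M.pre.inner_sum_right _ _ _
  rw [e]
  exact Finset.sum_nonneg fun k _ => M.inner_self_nonneg _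

/-- The algebraic tensor product `X ⊙ M` with the semi-inner product
`⟨x ⊗ m, y ⊗ n⟩ = ⟨m, ⟨x, y⟩ • n⟩ = ⟨⟨y, x⟩ • m, n⟩`. The factors are written in the order `M ⊗[ℂ] X`
so that the right action `(x ⊗ m) · a = x ⊗ (m · a)` is the one on the first factor. -/
def tensorPre : PreHilbertModule A (M ⊗[ℂ] X) where
  inner z w := X.tensorForm M z w
  inner_add_right z w w' := map_add _ w w'
  inner_smul_right := X.tensorForm_smul_right M
  star_inner := X.star_tensorForm M
  inner_self_nonneg := X.tensorForm_self_nonneg M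

/-- The internal tensor product `X ⊗_A M`. -/
def tensor : RightHilbertModule A := (X.tensorPre M).completion

variable {X M}

/-- The elementary tensor `x ⊗ m` in `X ⊗_A M`. -/
def tmul (x : X) (m : M) : X.tensor M := (X.tensorPre M).of (m ⊗ₜ x)

lemma inner_tmul (x y : X) (m n : M) :
    (X.tensor M).inner (tmul x m) (tmul y n) = M.inner (X.inner y x • m) n := by
  rw [M.inner_left_smul, X.star_inner]
  exact (X.tensorPre M).inner_of _ _

lemma tmul_smul (x : X) (m : M) (a : A) :
    (tmul x (m <• a) : X.tensor M) = tmul x m <• a :=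
  ((X.tensorPre M).of.map_smul (MulOpposite.op a) (m ⊗ₜ x)).symm ▸ rfl

/-- Two inner-product preserving maps on `X ⊗_A M` that agree on elementary tensors are equal. -/
lemma tensor_ext {Z : RightHilbertModule A} {f g : InnerMap (X.tensor M) Z}
    (h : ∀ x m, f (tmul x m) = g (tmul x m)) : f = g := by
  refine PreHilbertModule.completion_ext fun z => ?_
  induction z using TensorProduct.induction_on with
  | zero => rw [map_zero]; exact (map_zero f).trans (map_zero g).symm
  | add _ _ hz hw =>
    rw [map_add]
    exact (map_add f _ _).trans ((congrArg₂ _ hz hw).trans (map_add g _ _).symm)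
  | tmul m x => exact h x m

end RightHilbertModule

variable [StarOrderedRing A] {X Y Z : RightHilbertModule A}

namespace InnerMap

lemma tensorForm_map (f : InnerMap X Y) (M : CStarCorrespondence A) (z w : M ⊗[ℂ] X) :
    Y.tensorForm M (TensorProduct.AlgebraTensorModule.map (LinearMap.id : M →ₗ[Aᵐᵒᵖ] M)
        ((f : X →ₗ[Aᵐᵒᵖ] Y).restrictScalars ℂ) z)
      (TensorProduct.AlgebraTensorModule.map (LinearMap.id : M →ₗ[Aᵐᵒᵖ] M)
        ((f : X →ₗ[Aᵐᵒᵖ] Y).restrictScalars ℂ) w) = X.tensorForm M z w := by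
  induction z using TensorProduct.induction_on with
  | zero => simp
  | add z z' hz hz' => rw [map_add, map_add, map_add, LinearMap.add_apply, LinearMap.add_apply,
      hz, hz']
  | tmul m x =>
    induction w using TensorProduct.induction_on with
    | zero => simp
    | add w w' hw hw' => rw [map_add, map_add, map_add, hw, hw']
    | tmul n y =>
      rw [TensorProduct.AlgebraTensorModule.map_tmul, TensorProduct.AlgebraTensorModule.map_tmul,
        RightHilbertModule.tensorForm_tmul, RightHilbertModule.tensorForm_tmul]
      exact congrArg (fun a => M.inner m (a • n)) (f.inner_apply x y)

/-- The inner-product preserving map `f ⊗ id : X ⊗_A M → Y ⊗_A M`. -/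
def tensorId (f : InnerMap X Y) (M : CStarCorrespondence A) :
    InnerMap (X.tensor M) (Y.tensor M) :=
  PreHilbertModule.completionMap
    (TensorProduct.AlgebraTensorModule.map (LinearMap.id : M →ₗ[Aᵐᵒᵖ] M)
      ((f : X →ₗ[Aᵐᵒᵖ] Y).restrictScalars ℂ)) (f.tensorForm_map M)

@[simp] lemma tensorId_tmul (f : InnerMap X Y) (M : CStarCorrespondence A) (x : X) (m : M) :
    f.tensorId M (RightHilbertModule.tmul x m) = RightHilbertModule.tmul (f x) m :=
  PreHilbertModule.completionMap_of _ _ _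

end InnerMap

namespace InnerEquiv

/-- The isomorphism `f ⊗ id : X ⊗_A M → Y ⊗_A M`. -/
def tensorId (f : InnerEquiv X Y) (M : CStarCorrespondence A) :
    InnerEquiv (X.tensor M) (Y.tensor M) where
  toLinearEquiv := LinearEquiv.ofLinearMap (f.toInnerMap.tensorId M).toLinearMap
    (f.symm.toInnerMap.tensorId M).toLinearMap
    (LinearMap.ext fun z => DFunLike.congr_fun (RightHilbertModule.tensor_ext
      (f := (f.toInnerMap.tensorId M).comp (f.symm.toInnerMap.tensorId M))
      (g := InnerMap.id _) fun x m => by simp) z)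
    (LinearMap.ext fun z => DFunLike.congr_fun (RightHilbertModule.tensor_ext
      (f := (f.symm.toInnerMap.tensorId M).comp (f.toInnerMap.tensorId M))
      (g := InnerMap.id _) fun x m => by simp) z)
  inner_map := (f.toInnerMap.tensorId M).inner_map

@[simp] lemma tensorId_tmul (f : InnerEquiv X Y) (M : CStarCorrespondence A) (x : X) (m : M) :
    f.tensorId M (RightHilbertModule.tmul x m) = RightHilbertModule.tmul (f x) m :=
  InnerMap.tensorId_tmul f.toInnerMap M x m

end InnerEquiv

end Tensor

section Powers

variable {A : Type u} [CStarAlgebra A] [PartialOrder A] [StarOrderedRing A]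

/-- The modules `X ⊗_A M^{⊗ k}`, bracketed to the left:
`X ⊗_A M^{⊗ 0} = X` and `X ⊗_A M^{⊗ (k + 1)} = (X ⊗_A M^{⊗ k}) ⊗_A M`. -/
def RightHilbertModule.tensorPow (X : RightHilbertModule A) (M : CStarCorrespondence A) :
    ℕ → RightHilbertModule A
  | 0 => X
  | k + 1 => (X.tensorPow M k).tensor M

/-- The elementary tensor `x ⊗ m₁ ⊗ ⋯ ⊗ mₖ`. -/
def RightHilbertModule.tprod {X : RightHilbertModule A} {M : CStarCorrespondence A} (x : X) :
    ∀ {k : ℕ}, (Fin k → M) → X.tensorPow M k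
  | 0, _ => x
  | _ + 1, m => RightHilbertModule.tmul (RightHilbertModule.tprod x fun i => m i.castSucc)
      (m (Fin.last _))

/-- The maps `T ⊗ idₖ : Y ⊗_A M^{⊗ k} → Y ⊗_A M^{⊗ (k + 1)}` associated to `T : Y → Y ⊗_A M`. -/
def InnerMap.tensorIdPow {Y : RightHilbertModule A} {M : CStarCorrespondence A}
    (T : InnerMap Y (Y.tensor M)) : ∀ k, InnerMap (Y.tensorPow M k) (Y.tensorPow M (k + 1))
  | 0 => T
  | k + 1 => (T.tensorIdPow k).tensorId M

/-- The powers `U^k : Y → Y ⊗_A M^{⊗ k}` of an isomorphism `U : Y → Y ⊗_A M`, with `U^0 = id` and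
`U^{k + 1} = (U^k ⊗ id) ∘ U`. -/
def InnerEquiv.dilationPow {Y : RightHilbertModule A} {M : CStarCorrespondence A}
    (U : InnerEquiv Y (Y.tensor M)) : ∀ k, InnerEquiv Y (Y.tensorPow M k)
  | 0 => InnerEquiv.refl Y
  | k + 1 => U.trans ((U.dilationPow k).tensorId M)

end Powers

section DirectLimit

variable {A : Type u} [CStarAlgebra A] [PartialOrder A]
  (X : ℕ → RightHilbertModule A) (T : ∀ k, InnerMap (X k) (X (k + 1)))

/-- The composite `T_{j-1} ∘ ⋯ ∘ T_i : X_i → X_j` in a direct system. -/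
def transition (i j : ℕ) (h : i ≤ j) : InnerMap (X i) (X j) :=
  Nat.leRecOn h (fun {k} f => (T k).comp f) (InnerMap.id (X i))

lemma transition_self (i : ℕ) (x : X i) : transition X T i i le_rfl x = x := by
  unfold transition
  rw [Nat.leRecOn_self]
  rfl

lemma transition_succ (i j : ℕ) (h : i ≤ j) (x : X i) :
    transition X T i (j + 1) (h.trans (Nat.le_succ j)) x = T j (transition X T i j h x) := by
  unfold transition
  rw [Nat.leRecOn_succ h]
  rfl

instance : DirectedSystem (fun k => X k) (fun _ _ h => transition X T _ _ h) where
  map_self i x := transition_self X T i x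
  map_map k j i hij hjk x := by
    induction k, hjk using Nat.le_induction with
    | base => exact transition_self X T _ _
    | succ n hn ih =>
      rw [transition_succ X T _ _ hn, transition_succ X T _ _ (hij.trans hn), ih]

/-- The algebraic direct limit of a sequence of Hilbert modules. -/
abbrev AlgLimit : Type u := DirectLimit (fun k => X k) (transition X T)

instance : Module ℂ (AlgLimit X T) := Module.compHom _ (algebraMap ℂ Aᵐᵒᵖ)

instance : IsScalarTower ℂ Aᵐᵒᵖ (AlgLimit X T) where
  smul_assoc c a x := by
    rw [Algebra.smul_def, mul_smul]
    rfl

/-- The inner product on the algebraic direct limit: `⟨[x], [y]⟩ = ⟨x, y⟩` for `x` and `y` in the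
same `X_k`. -/
def algLimitPre : PreHilbertModule A (AlgLimit X T) where
  inner := DirectLimit.lift₂ (transition X T) (transition X T) (fun k x y => (X k).inner x y)
    fun i j h x y => ((transition X T i j h).inner_apply x y).symm
  inner_add_right x y z := by
    induction x, y, z using DirectLimit.induction₃ with
    | ih i x y z =>
      rw [DirectLimit.add_def, DirectLimit.lift₂_def, DirectLimit.lift₂_def,
        DirectLimit.lift₂_def, (X i).inner_add_right]
  inner_smul_right x y a := by
    induction x, y using DirectLimit.induction₂ with
    | ih i x y =>
      rw [DirectLimit.smul_def, DirectLimit.lift₂_def, DirectLimit.lift₂_def,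
        (X i).inner_smul_right]
  star_inner x y := by
    induction x, y using DirectLimit.induction₂ with
    | ih i x y => rw [DirectLimit.lift₂_def, DirectLimit.lift₂_def, (X i).star_inner]
  inner_self_nonneg x := by
    induction x using DirectLimit.induction with
    | ih i x =>
      rw [DirectLimit.lift₂_def]
      exact (X i).inner_self_nonneg x

variable [StarOrderedRing A]

/-- The direct limit Hilbert module of a sequence of Hilbert modules and inner-product preserving
maps: the completion of the algebraic direct limit. -/
def limitModule : RightHilbertModule A := (algLimitPre X T).completion

/-- The canonical map of `X_k` into the direct limit. -/
def limitMap (k : ℕ) : InnerMap (X k) (limitModule X T) where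
  toFun x := (algLimitPre X T).of ⟦⟨k, x⟩⟧
  map_add' x y := by
    refine Eq.trans ?_ ((algLimitPre X T).of.map_add _ _)
    rw [DirectLimit.add_def]
  map_smul' a x := by
    refine Eq.trans ?_ ((algLimitPre X T).of.map_smul a _)
    rw [DirectLimit.smul_def]
  inner_map x y := by
    refine ((algLimitPre X T).inner_of _ _).trans ?_
    exact DirectLimit.lift₂_def (transition X T) (transition X T)
      (fun k x y => (X k).inner x y)
      (fun i j h x y => ((transition X T i j h).inner_apply x y).symm) k x y

lemma limitMap_comp (k : ℕ) (x : X k) : limitMap X T (k + 1) (T k x) = limitMap X T k x := by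
  have h := DirectLimit.mk_apply (f := transition X T) k (k + 1) x (Nat.le_succ k)
  rw [transition_succ X T k k le_rfl, transition_self] at h
  exact congrArg (algLimitPre X T).of h

end DirectLimit

section Correspondences

open UniformSpace

variable {A : Type u} [CStarAlgebra A] [PartialOrder A]

/-- An `A`-valued semi-inner product on a right `A`-module that also carries a left action of `A` by
adjointable operators. -/
structure PreCorrespondence (A E : Type u) [CStarAlgebra A] [PartialOrder A] [AddCommGroup E]
    [Module ℂ E] [Module Aᵐᵒᵖ E] [IsScalarTower ℂ Aᵐᵒᵖ E] [Module A E] [IsScalarTower ℂ A E]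
    extends PreHilbertModule A E where
  inner_left_smul : ∀ (a : A) x y, inner (a • x) y = inner x (star a • y)

namespace PreCorrespondence

variable {E : Type u} [AddCommGroup E] [Module ℂ E] [Module Aᵐᵒᵖ E] [IsScalarTower ℂ Aᵐᵒᵖ E]
  [Module A E] [IsScalarTower ℂ A E] [StarOrderedRing A] (P : PreCorrespondence A E)

instance : Module A P.toPreHilbertModule.Space := inferInstanceAs (Module A E)

instance : IsScalarTower ℂ A P.toPreHilbertModule.Space := inferInstanceAs (IsScalarTower ℂ A E)

lemma inner_left_smul_self_le (a : A) (x : E) :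
    P.inner (a • x) (a • x) ≤ ‖a‖ ^ 2 • P.inner x x := by
  obtain ⟨b, hb⟩ : ∃ b : A, algebraMap ℝ A (‖a‖ ^ 2) - star a * a = star b * b := by
    refine CStarAlgebra.nonneg_iff_eq_star_mul_self.1 (sub_nonneg.2 ?_)
    have h := IsSelfAdjoint.le_algebraMap_norm_self (IsSelfAdjoint.star_mul_self a)
    rwa [CStarRing.norm_star_mul_self, ← sq] at h
  have h0 : 0 ≤ P.inner (b • x) (b • x) := P.inner_self_nonneg _
  have hc : (algebraMap ℝ A (‖a‖ ^ 2)) • x = ((‖a‖ ^ 2 : ℝ) : ℂ) • x := by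
    rw [Algebra.algebraMap_eq_smul_one, ← Complex.coe_smul, smul_assoc, one_smul]
  rw [P.inner_left_smul, smul_smul, ← hb, sub_smul, P.toPreHilbertModule.inner_sub_right, hc,
    P.toPreHilbertModule.inner_csmul_right, Complex.coe_smul, sub_nonneg] at h0
  rwa [P.inner_left_smul, smul_smul]

lemma norm_left_smul_le (a : A) (x : P.toPreHilbertModule.Space) : ‖a • x‖ ≤ ‖a‖ * ‖x‖ := by
  have h : ‖a • x‖ ^ 2 ≤ (‖a‖ * ‖x‖) ^ 2 := by
    rw [P.toPreHilbertModule.norm_sq_eq, mul_pow, P.toPreHilbertModule.norm_sq_eq]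
    refine (CStarAlgebra.norm_le_norm_of_nonneg_of_le (P.inner_self_nonneg _)
      (P.inner_left_smul_self_le a x)).trans ?_
    rw [norm_smul, norm_pow, norm_norm]
    exact le_rfl
  exact le_of_sq_le_sq h (by positivity)

instance : UniformContinuousConstSMul A P.toPreHilbertModule.Space :=
  P.toPreHilbertModule.uniformContinuousConstSMul_of_bound fun a =>
    ⟨‖a‖, fun x => P.norm_left_smul_le a x⟩

lemma cip_left_smul (a : A) (x y : Completion P.toPreHilbertModule.Space) :
    P.toPreHilbertModule.cip (a • x) y = P.toPreHilbertModule.cip x (star a • y) := by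
  refine Completion.induction_on₂ x y (isClosed_eq ?_ ?_) fun x y => ?_
  · exact Continuous.cip _ ((continuous_const_smul a).comp continuous_fst) continuous_snd
  · exact Continuous.cip _ continuous_fst ((continuous_const_smul (star a)).comp continuous_snd)
  · rw [← Completion.coe_smul, ← Completion.coe_smul, PreHilbertModule.cip_coe,
      PreHilbertModule.cip_coe]
    exact P.inner_left_smul a x y

/-- The completion of a pre-correspondence. -/
def completion : CStarCorrespondence A where
  toRightHilbertModule := P.toPreHilbertModule.completion
  leftModule := inferInstanceAs (Module A (Completion P.toPreHilbertModule.Space))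
  leftIsScalarTower := inferInstanceAs (IsScalarTower ℂ A (Completion P.toPreHilbertModule.Space))
  inner_left_smul := P.cip_left_smul

end PreCorrespondence

/-- A transfer operator for the (unital) endomorphism `α` of `A`: a positive linear map `L` such
that `L (a α(b)) = L(a) b`. -/
structure TransferOperator (α : A →⋆ₐ[ℂ] A) where
  toLinearMap : A →ₗ[ℂ] A
  nonneg : ∀ a, 0 ≤ a → 0 ≤ toLinearMap a
  map_mul : ∀ a b, toLinearMap (a * α b) = toLinearMap a * b

/-- The vector space `A_L = A`, with the right action `m · a = m α(a)` and the left action by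
multiplication. -/
def TransferSpace (_ : A →⋆ₐ[ℂ] A) : Type u := A

namespace TransferSpace

variable (α : A →⋆ₐ[ℂ] A)

instance : AddCommGroup (TransferSpace α) := inferInstanceAs (AddCommGroup A)
instance : Module ℂ (TransferSpace α) := inferInstanceAs (Module ℂ A)
instance : Module A (TransferSpace α) := inferInstanceAs (Module A A)
instance : IsScalarTower ℂ A (TransferSpace α) := inferInstanceAs (IsScalarTower ℂ A A)

instance : Module Aᵐᵒᵖ (TransferSpace α) where
  smul a m := (show A from m) * α a.unop
  one_smul m := by
    change (show A from m) * α 1 = m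
    rw [map_one, mul_one]
  mul_smul a b m := by
    change (show A from m) * α (b.unop * a.unop) = (show A from m) * α b.unop * α a.unop
    rw [_root_.map_mul, mul_assoc]
  smul_zero a := zero_mul (α a.unop)
  smul_add a m n := add_mul (show A from m) (show A from n) (α a.unop)
  add_smul a b m := by
    change (show A from m) * α (a.unop + b.unop) = _
    rw [map_add, mul_add]
    rfl
  zero_smul m := by
    change (show A from m) * α 0 = 0
    rw [map_zero, mul_zero]

lemma op_smul_def (m : TransferSpace α) (a : A) : m <• a = ((show A from m) * α a : A) := rfl

instance : IsScalarTower ℂ Aᵐᵒᵖ (TransferSpace α) where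
  smul_assoc c a m := by
    change (show A from m) * α (c • a.unop) = c • ((show A from m) * α a.unop)
    rw [map_smul, mul_smul_comm]

end TransferSpace

namespace TransferOperator

variable {α : A →⋆ₐ[ℂ] A} [StarOrderedRing A] (L : TransferOperator α)

lemma map_star (a : A) : L.toLinearMap (star a) = star (L.toLinearMap a) := by
  obtain ⟨y, hy, -, ha⟩ := CStarAlgebra.exists_sum_four_nonneg a
  have hs : ∀ i, star (y i) = y i := fun i => (hy i).isSelfAdjoint
  have hL : ∀ i, star (L.toLinearMap (y i)) = L.toLinearMap (y i) :=
    fun i => (L.nonneg _ (hy i)).isSelfAdjoint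
  rw [ha]
  simp only [star_sum, star_smul, map_sum, map_smul, hs, hL]

/-- The pre-correspondence structure `⟨m, n⟩ = L(m* n)` on `A_L`. -/
def pre : PreCorrespondence A (TransferSpace α) where
  inner m n := L.toLinearMap (star (show A from m) * (show A from n))
  inner_add_right m n n' := by
    change L.toLinearMap (star (show A from m) * ((show A from n) + (show A from n'))) = _
    rw [mul_add, map_add]
  inner_smul_right m n a := by
    change L.toLinearMap (star (show A from m) * ((show A from n) * α a)) = _
    rw [← mul_assoc, L.map_mul]
  star_inner m n := by
    rw [← L.map_star, star_mul, star_star]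
  inner_self_nonneg m := L.nonneg _ (star_mul_self_nonneg _)
  inner_left_smul a m n := by
    change L.toLinearMap (star (a * (show A from m)) * (show A from n)) =
      L.toLinearMap (star (show A from m) * (star a * (show A from n)))
    rw [star_mul, mul_assoc]

/-- Exel's correspondence `M_L`: the completion of `A_L`. -/
def correspondence : CStarCorrespondence A := L.pre.completion

/-- The canonical map `A = A_L → M_L`. -/
def toM (a : A) : L.correspondence := L.pre.toPreHilbertModule.of (show TransferSpace α from a)

lemma inner_toM (a b : A) :
    L.correspondence.inner (L.toM a) (L.toM b) = L.toLinearMap (star a * b) :=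
  L.pre.toPreHilbertModule.inner_of _ _

end TransferOperator

end Correspondences

section LocalHomeomorphism

variable {C : Type u} [TopologicalSpace C] [CompactSpace C] [T2Space C]

/-- The endomorphism `f ↦ f ∘ σ` of `C(C)`. -/
def pullbackHom (σ : C(C, C)) : C(C, ℂ) →⋆ₐ[ℂ] C(C, ℂ) := ContinuousMap.compStarAlgHom' ℂ ℂ σ

/-- The average `|σ⁻¹(c)|⁻¹ ∑_{σ(d) = c} f(d)` of `f` over the fibre of `σ` at `c`. -/
def fibreAverage (σ : C(C, C)) (f : C → ℂ) (c : C) : ℂ :=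
  (Nat.card (σ ⁻¹' {c}) : ℂ)⁻¹ * ∑ᶠ d : σ ⁻¹' {c}, f d

lemma finite_fibre {σ : C(C, C)} (hσ : IsLocalHomeomorph σ) (c : C) : Finite (σ ⁻¹' {c}) := by
  have hd : DiscreteTopology (σ ⁻¹' {c}) :=
    (isLocalHomeomorph_iff_isCoveringMap.1 hσ c).discreteTopology_fiber
  have hc : CompactSpace (σ ⁻¹' {c}) :=
    isCompact_iff_compactSpace.1 ((isClosed_singleton.preimage σ.continuous).isCompact)
  exact finite_of_compact_of_discrete

lemma continuous_fibreAverage {σ : C(C, C)} (hσ : IsLocalHomeomorph σ) (f : C(C, ℂ)) :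
    Continuous (fibreAverage σ f) := by
  rw [continuous_iff_continuousAt]
  intro c₀
  have hfin := finite_fibre hσ c₀
  obtain ⟨_, U, hcU, hU, _, H, hH⟩ := isLocalHomeomorph_iff_isCoveringMap.1 hσ c₀
  have hfI : Fintype (σ ⁻¹' {c₀}) := Fintype.ofFinite _
  let s : U → (σ ⁻¹' {c₀}) → C := fun c i => (H.symm (c, i)).1
  have hs : ∀ c i, σ (s c i) = c.1 := fun c i => by
    have := hH (H.symm (c, i))
    rw [H.apply_symm_apply] at this
    exact this.symm
  have hbij : ∀ c : U, Function.Bijective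
      (fun i => (⟨s c i, hs c i⟩ : σ ⁻¹' {c.1})) := by
    intro c
    constructor
    · intro i j hij
      have h0 : s c i = s c j := (Subtype.mk.injEq _ _ _ _).mp hij
      have h1 : H.symm (c, i) = H.symm (c, j) := Subtype.ext h0
      exact congrArg Prod.snd (H.symm.injective h1)
    · rintro ⟨d, hd⟩
      have hdU : d ∈ σ ⁻¹' U := by
        have : σ d = c.1 := hd
        simp [this]
      refine ⟨(H ⟨d, hdU⟩).2, Subtype.ext ?_⟩
      have h1 : (H ⟨d, hdU⟩).1 = c := Subtype.ext ((hH ⟨d, hdU⟩).trans hd)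
      have h2 : (c, (H ⟨d, hdU⟩).2) = H ⟨d, hdU⟩ := Prod.ext h1.symm rfl
      change (H.symm (c, (H ⟨d, hdU⟩).2)).1 = d
      rw [h2, H.symm_apply_apply]
  have heq : ∀ c : U, fibreAverage σ f c =
      (Nat.card (σ ⁻¹' {c₀}) : ℂ)⁻¹ * ∑ i, f (s c i) := by
    intro c
    unfold fibreAverage
    rw [← Nat.card_eq_of_bijective _ (hbij c),
      ← finsum_eq_of_bijective (f := fun i => f (s c i)) _ (hbij c) (fun _ => rfl),
      finsum_eq_sum_of_fintype]
  have hcont : Continuous fun c : U => fibreAverage σ f c := by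
    simp only [heq]
    have hsc : ∀ i, Continuous fun c : U => s c i := fun i =>
      continuous_subtype_val.comp (H.symm.continuous.comp (by fun_prop))
    exact continuous_const.mul (continuous_finsetSum _ fun i _ => f.continuous.comp (hsc i))
  exact (continuousOn_iff_continuous_domRestrict.2 hcont).continuousAt (hU.mem_nhds hcU)

/-- The transfer operator `L(f)(c) = |σ⁻¹(c)|⁻¹ ∑_{σ(d) = c} f(d)` for `f ↦ f ∘ σ`, where `σ` is a
local homeomorphism of a compact space. -/
def averagingTransfer (σ : C(C, C)) (hσ : IsLocalHomeomorph σ) :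
    TransferOperator (pullbackHom σ) where
  toLinearMap :=
    { toFun := fun f => ⟨fibreAverage σ f, continuous_fibreAverage hσ f⟩
      map_add' := fun f g => by
        ext c
        have := finite_fibre hσ c
        change fibreAverage σ (fun d => f d + g d) c = fibreAverage σ f c + fibreAverage σ g c
        unfold fibreAverage
        rw [finsum_add_distrib (Set.toFinite _) (Set.toFinite _), mul_add]
      map_smul' := fun a f => by
        ext c
        have hfin := finite_fibre hσ c
        have hfI : Fintype (σ ⁻¹' {c}) := Fintype.ofFinite _
        change fibreAverage σ (fun d => a * f d) c = a * fibreAverage σ f c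
        simp only [fibreAverage, finsum_eq_sum_of_fintype]
        rw [← Finset.mul_sum, mul_left_comm] }
  nonneg f hf := by
    rw [ContinuousMap.le_def] at hf ⊢
    intro c
    change 0 ≤ fibreAverage σ f c
    unfold fibreAverage
    refine mul_nonneg ?_ (finsum_nonneg fun d => hf d)
    rw [← Complex.ofReal_natCast, ← Complex.ofReal_inv, Complex.zero_le_real]
    positivity
  map_mul f g := by
    ext c
    have hfin := finite_fibre hσ c
    have hfI : Fintype (σ ⁻¹' {c}) := Fintype.ofFinite _
    change fibreAverage σ (fun d => f d * g (σ d)) c = fibreAverage σ f c * g c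
    simp only [fibreAverage, finsum_eq_sum_of_fintype]
    rw [mul_assoc, Finset.sum_mul]
    congr 1
    refine Finset.sum_congr rfl fun d _ => ?_
    have hd : σ d.1 = c := d.2
    rw [hd]

end LocalHomeomorphism

section Frames

variable {A : Type u} [CStarAlgebra A] [PartialOrder A]

/-- `(x i)` is a Parseval frame for the submodule `V` of `X`: the `x i` belong to `V` and
`⟨y, y⟩ = ∑ᵢ ⟨y, x i⟩ ⟨x i, y⟩`, with convergence in norm, for every `y ∈ V`. -/
def IsParsevalFrame {X : RightHilbertModule A} {ι : Type*} (V : Submodule Aᵐᵒᵖ X) (x : ι → X) :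
    Prop :=
  (∀ i, x i ∈ V) ∧
    ∀ y ∈ V, HasSum (fun i => X.inner y (x i) * X.inner (x i) y) (X.inner y y)

/-- The family `(x i)` is orthonormal: `⟨x i, x j⟩ = δ_{ij} 1`. -/
def IsOrthonormalFamily {X : RightHilbertModule A} {ι : Type*} (x : ι → X) : Prop :=
  (∀ i, X.inner (x i) (x i) = 1) ∧ ∀ i j, i ≠ j → X.inner (x i) (x j) = 0

/-- `(x i)` is an orthonormal basis for the submodule `V` of `X`: it is an orthonormal family in `V`
and `V` is contained in the closed submodule generated by the `x i`. -/
def IsOrthonormalModuleBasis {X : RightHilbertModule A} {ι : Type*} (V : Submodule Aᵐᵒᵖ X)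
    (x : ι → X) : Prop :=
  IsOrthonormalFamily x ∧ (∀ i, x i ∈ V) ∧
    (V : Set X) ⊆ closure (Submodule.span Aᵐᵒᵖ (Set.range x) : Set X)

/-- The range of an inner-product preserving map, as a submodule. -/
def InnerMap.range {X Y : RightHilbertModule A} (Q : InnerMap X Y) : Submodule Aᵐᵒᵖ Y :=
  LinearMap.range Q.toLinearMap

variable [StarOrderedRing A]

/-- The identity of `A`, as an element of the Hilbert module `A_A`. -/
def RightHilbertModule.selfOne (A : Type u) [CStarAlgebra A] [PartialOrder A]
    [StarOrderedRing A] : RightHilbertModule.self A := (1 : A)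

open RightHilbertModule

/-- The isometry `S_m : A_A → M ≅ A_A ⊗_A M`, `a ↦ m · a ≅ 1 ⊗ (m · a)`, associated to a filter `m`,
that is, an element of `M` such that `⟨m, m⟩ = 1`. -/
def filterMap (M : CStarCorrespondence A) (m : M) (hm : M.inner m m = 1) :
    InnerMap (RightHilbertModule.self A) ((RightHilbertModule.self A).tensor M) where
  toFun a := tmul (selfOne A) (m <• (show A from a))
  map_add' a b := by
    change tmul (selfOne A) (m <• ((show A from a) + (show A from b))) = _
    rw [MulOpposite.op_add, add_smul]
    exact (congrArg _ (TensorProduct.add_tmul _ _ _)).trans (map_add _ _ _)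
  map_smul' b a := by
    change tmul (selfOne A) (m <• ((show A from a) * b.unop)) = b • tmul (selfOne A) _
    rw [MulOpposite.op_mul, mul_smul]
    exact tmul_smul _ _ b.unop
  inner_map a b := by
    rw [inner_tmul]
    change M.inner ((star (1 : A) * 1) • _) _ = star (show A from a) * (show A from b)
    rw [star_one, one_mul, one_smul, M.inner_smul_right]
    have h : M.inner (m <• (show A from a)) m = star (show A from a) * M.inner m m :=
      M.pre.inner_smul_left _ _ _
    rw [h, hm, mul_one]

/-- The direct limit `M_∞` of the modules `M^{⊗ k} ≅ A_A ⊗_A M^{⊗ k}` with respect to the maps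
`S_m ⊗ idₖ : n ↦ m ⊗ n`. -/
def filterLimit (M : CStarCorrespondence A) (m : M) (hm : M.inner m m = 1) :
    RightHilbertModule A :=
  limitModule (fun k => (RightHilbertModule.self A).tensorPow M k)
    (fun k => (filterMap M m hm).tensorIdPow k)

/-- The canonical map `ι^k : M^{⊗ k} → M_∞`. -/
def filterLimitMap (M : CStarCorrespondence A) (m : M) (hm : M.inner m m = 1) (k : ℕ) :
    InnerMap ((RightHilbertModule.self A).tensorPow M k) (filterLimit M m hm) :=
  limitMap (fun k => (RightHilbertModule.self A).tensorPow M k)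
    (fun k => (filterMap M m hm).tensorIdPow k) k

/-- `(X, D, φ)` is a scaling function for `m`. -/
def IsScalingFunction {M : CStarCorrespondence A} (m : M) {X : RightHilbertModule A}
    (D : InnerEquiv X (X.tensor M)) (φ : X) : Prop :=
  X.inner φ φ = 1 ∧ D φ = tmul φ m

/-- `R` is the isomorphism `M_∞ ≅ M_∞ ⊗_A M` such that `R ∘ ι^{k+1} = ι^k ⊗ id`, and `Q` is the
inner-product preserving map `M_∞ → X` such that `Q (ι^0 1) = φ` and `D ∘ Q = (Q ⊗ id) ∘ R`. -/
structure IsRealization {M : CStarCorrespondence A} {m : M} {hm : M.inner m m = 1}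
    {X : RightHilbertModule A} (D : InnerEquiv X (X.tensor M)) (φ : X)
    (R : InnerEquiv (filterLimit M m hm) ((filterLimit M m hm).tensor M))
    (Q : InnerMap (filterLimit M m hm) X) : Prop where
  shift : ∀ k z, R (filterLimitMap M m hm (k + 1) z) = (filterLimitMap M m hm k).tensorId M z
  base : Q (filterLimitMap M m hm 0 (selfOne A)) = φ
  intertwine : ∀ z, D (Q z) = Q.tensorId M (R z)

/-- The index set of the frame: `none`, and the tuples `(j₁, …, j_{k+1})`, `k ≥ 0`, with
`j₁ ≠ j₀`. -/
abbrev FrameIndex {J : Type*} (j₀ : J) : Type _ :=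
  Option (Σ k : ℕ, {j : Fin (k + 1) → J // j 0 ≠ j₀})

/-- The family consisting of `φ` and of the vectors `D^{-k} (φ ⊗ m_{j₁} ⊗ ⋯ ⊗ m_{jₖ})`, where
`k ≥ 1` and `j₁ ≠ j₀`. -/
def frameVector {M : CStarCorrespondence A} {X : RightHilbertModule A}
    (D : InnerEquiv X (X.tensor M)) (φ : X) {J : Type*} (j₀ : J) (m : J → M) :
    FrameIndex j₀ → X
  | none => φ
  | some ⟨k, j⟩ => (D.dilationPow (k + 1)).symm (tprod φ fun l => m (j.1 l))

/-- `D` is an isomorphism of `X` onto `X_L`, the vector space `X` with the right action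
`x ·_L a = x · α(a)` and the inner product `⟨x, y⟩_L = L(⟨x, y⟩)`. -/
structure IsTransferDilation {α : A →⋆ₐ[ℂ] A} (L : TransferOperator α)
    {X : RightHilbertModule A} (D : X ≃ₗ[ℂ] X) : Prop where
  map_smul : ∀ (x : X) (a : A), D (x <• a) = D x <• α a
  inner_map : ∀ x y, L.toLinearMap (X.inner (D x) (D y)) = X.inner x y

/-- `R : M_∞ → (M_∞)_L` is the isomorphism `M_∞ ≅ M_∞ ⊗_A M_L` such that `R ∘ ι^{k+1} = ι^k ⊗ id`,
followed by the identification `x ⊗ a ↦ x · a` of `M_∞ ⊗_A M_L` with `(M_∞)_L`, and `Q` is the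
inner-product preserving map `M_∞ → X` such that `Q (ι^0 1) = φ` and `D ∘ Q = Q ∘ R`. -/
structure IsTransferRealization {α : A →⋆ₐ[ℂ] A} {L : TransferOperator α}
    {m : L.correspondence} {hm : L.correspondence.inner m m = 1}
    {X : RightHilbertModule A} (D : X ≃ₗ[ℂ] X) (φ : X)
    (R : filterLimit L.correspondence m hm ≃ₗ[ℂ] filterLimit L.correspondence m hm)
    (Q : InnerMap (filterLimit L.correspondence m hm) X) : Prop where
  dilation : IsTransferDilation L R
  shift : ∀ (k : ℕ) (z : (RightHilbertModule.self A).tensorPow L.correspondence k) (a : A),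
    R (filterLimitMap L.correspondence m hm (k + 1) (tmul z (L.toM a))) =
      filterLimitMap L.correspondence m hm k z <• a
  base : Q (filterLimitMap L.correspondence m hm 0 (selfOne A)) = φ
  intertwine : ∀ z, D (Q z) = Q (R z)

/-- The family consisting of `φ` and of the vectors
`D^{-k} (φ · (m_{j₁} α(m_{j₂}) ⋯ α^{k-1}(m_{jₖ})))`, where `k ≥ 1` and `j₁ ≠ j₀`, for a commutative
algebra such as `C(C)`. -/
def transferFrameVector {C : Type u} [TopologicalSpace C] [CompactSpace C]
    (α : C(C, ℂ) →⋆ₐ[ℂ] C(C, ℂ)) {X : RightHilbertModule C(C, ℂ)} (D : X ≃ₗ[ℂ] X) (φ : X)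
    {J : Type*} (j₀ : J) (m : J → C(C, ℂ)) : FrameIndex j₀ → X
  | none => φ
  | some ⟨k, j⟩ => D.symm^[k + 1] (φ <• ∏ l : Fin (k + 1), α^[(l : ℕ)] (m (j.1 l)))

end Frames

end

/-! Every space here is a completion, and every map preserves inner products, hence is isometric. So
a map out of $M_\infty$ is the same as a compatible family of maps out of the $M^{\otimes k}$
(`limitLift`), and such a map is onto as soon as its range, which is closed, contains a dense set.
$R$ is assembled from the maps $\iota^k\otimes\mathrm{id}$; its range contains every
$\iota^k(x)\otimes n$. $Q$ is assembled from $q_0(a)=\phi\cdot a$ and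
$q_{k+1}=D^{-1}(q_k\otimes\mathrm{id})$; compatibility in degree zero is exactly $D\phi=\phi\otimes
m_0$, and functoriality of $\otimes$ propagates it. Since $D$ is injective, the same recursion
forces the values of $Q$.

The frame is handled through a recursion rather than through the explicit powers of $D$: a family
$e$ on tuples with $e_\emptyset=\phi$ and $D e_{(i,j)}=e_i\otimes m_j$. The convention that
appending $j_0$ to the empty tuple gives the empty tuple makes appending a bijection (`stepEquiv`),
and the recursion is then consistent because $D\phi=\phi\otimes m_0$. Consequently $D$ turns the
Parseval identity for $e$ on the range of $q_{k+1}$ into the identity for the family $e_i\otimes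
m_j$ on the range of $q_k\otimes\mathrm{id}$, which follows from the identity on the range of $q_k$
(`InnerMap.hasSum_tensorId`). The induction starts on $\phi\cdot A$, where only $\phi$ itself
contributes: a unit vector of a Parseval frame is orthogonal to the other frame vectors, and this
passes from $(m_j)$ to $e$. Finally `hasSum_inner_of_dense` carries the identity from the images of
the $\iota^k$ to all of $M_\infty$. Inner products of the $e_i$ obey the same recursion, which gives
orthonormality when $(m_j)$ is orthonormal.

Convergence is controlled by order: for positive terms, a sum is an upper bound of the partial sums
that they approximate in norm. This permits iterated sums to be merged and limits to be taken on
dense sets.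

Part (2) reduces to part (1). The map $x\mapsto x\otimes 1$ preserves inner products from $X_L$ to
$X\otimes_A M_L$ and hits all $x\otimes a=(x\cdot a)\otimes 1$. Its range is closed because
$\|a\|\le K\|L(a)\|$ for $a\ge 0$, where $K$ bounds the cardinalities of the fibres; such a bound
exists by compactness. Dilations of $X$ thereby become isomorphisms $X\cong X\otimes_A M_L$, and
realizations correspond. -/

noncomputable section

open RightHilbertModule

/-! ### Inner-product preserving maps as isometries -/

section InnerMapTopology

variable {A : Type u} [CStarAlgebra A] [PartialOrder A] {X Y : RightHilbertModule A}

lemma InnerMap.norm_map (f : InnerMap X Y) (x : X) : ‖f x‖ = ‖x‖ := by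
  rw [Y.norm_eq, X.norm_eq, f.inner_apply]

lemma InnerMap.isometry (f : InnerMap X Y) : Isometry f :=
  AddMonoidHomClass.isometry_of_norm f f.norm_map

/-- The domain is complete. This reduces surjectivity of such a map to density of its range. -/
lemma InnerMap.isClosed_range (f : InnerMap X Y) : IsClosed (Set.range f) :=
  f.isometry.isClosedEmbedding.isClosed_range

lemma InnerEquiv.isometry (f : InnerEquiv X Y) : Isometry f := f.toInnerMap.isometry

/-- A surjective inner-product preserving map is an isomorphism. -/
def InnerMap.equivOfSurjective (f : InnerMap X Y) (hf : Function.Surjective f) :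
    InnerEquiv X Y where
  toLinearEquiv := LinearEquiv.ofBijective f.toLinearMap ⟨f.isometry.injective, hf⟩
  inner_map := f.inner_map

@[simp] lemma InnerMap.equivOfSurjective_apply (f : InnerMap X Y) (hf : Function.Surjective f)
    (x : X) : f.equivOfSurjective hf x = f x := rfl

end InnerMapTopology

/-! ### Maps out of completions; continuity and induction for internal tensor products -/

section CompletionLift

open UniformSpace

variable {A E : Type u} [CStarAlgebra A] [PartialOrder A] [StarOrderedRing A]
  [AddCommGroup E] [Module ℂ E] [Module Aᵐᵒᵖ E] [IsScalarTower ℂ Aᵐᵒᵖ E]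
  {P : PreHilbertModule A E} {Y : RightHilbertModule A}

lemma PreHilbertModule.completion_induction {p : P.completion → Prop}
    (hc : IsClosed {z | p z}) (h : ∀ x, p (P.of x)) (z : P.completion) : p z :=
  Completion.induction_on (α := P.Space) z hc h

lemma RightHilbertModule.continuous_inner (Y : RightHilbertModule A) :
    Continuous fun p : Y × Y => Y.inner p.1 p.2 := by
  rw [continuous_iff_continuousAt]
  rintro ⟨x, y⟩
  rw [ContinuousAt, tendsto_iff_norm_sub_tendsto_zero]
  have hcs : ∀ x y : Y, ‖Y.inner x y‖ ≤ ‖x‖ * ‖y‖ := fun x y => by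
    rw [Y.norm_eq, Y.norm_eq]
    exact Y.pre.norm_inner_le x y
  have hb : ∀ p : Y × Y, ‖Y.inner p.1 p.2 - Y.inner x y‖ ≤
      ‖p.1 - x‖ * ‖p.2‖ + ‖x‖ * ‖p.2 - y‖ := by
    intro p
    have e : Y.inner p.1 p.2 - Y.inner x y = Y.inner (p.1 - x) p.2 + Y.inner x (p.2 - y) := by
      change _ = Y.pre.inner _ _ + Y.pre.inner _ _
      rw [Y.pre.inner_sub_left, Y.pre.inner_sub_right]
      change _ = Y.inner _ _ - Y.inner _ _ + (Y.inner _ _ - Y.inner _ _)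
      abel
    rw [e]
    exact (norm_add_le _ _).trans (add_le_add (hcs _ _) (hcs _ _))
  have hc : Filter.Tendsto (fun p : Y × Y => ‖p.1 - x‖ * ‖p.2‖ + ‖x‖ * ‖p.2 - y‖)
      (nhds (x, y)) (nhds (‖x - x‖ * ‖y‖ + ‖x‖ * ‖y - y‖)) := by
    have : Continuous (fun p : Y × Y => ‖p.1 - x‖ * ‖p.2‖ + ‖x‖ * ‖p.2 - y‖) := by
      fun_prop
    exact this.tendsto (x, y)
  simp only [sub_self, norm_zero, zero_mul, mul_zero, add_zero] at hc
  exact squeeze_zero (fun _ => norm_nonneg _) hb hc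

lemma Continuous.hilbert_inner {α : Type*} [TopologicalSpace α] {f g : α → Y}
    (hf : Continuous f) (hg : Continuous g) : Continuous fun x => Y.inner (f x) (g x) :=
  Y.continuous_inner.comp (hf.prodMk hg)

lemma RightHilbertModule.continuous_op_smul (Y : RightHilbertModule A) (a : Aᵐᵒᵖ) :
    Continuous fun y : Y => a • y := by
  have hl : ∀ y : Y, ‖a • y‖ ≤ ‖a.unop‖ * ‖y‖ := fun y => by
    rw [Y.norm_eq, Y.norm_eq]
    exact Y.pre.norm_op_smul_le a.unop y
  exact (AddMonoidHomClass.lipschitz_of_bound (DistribSMul.toAddMonoidHom Y a) ‖a.unop‖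
    hl).continuous

lemma PreHilbertModule.uniformContinuous_of_inner (f : E →ₗ[Aᵐᵒᵖ] Y)
    (hf : ∀ x y, Y.inner (f x) (f y) = P.inner x y) :
    UniformContinuous (fun x : P.Space => f x) := by
  let g : P.Space →+ Y := AddMonoidHom.mk' (fun x => f x) fun x y => f.map_add x y
  refine (AddMonoidHomClass.lipschitz_of_bound g 1 fun x => ?_).uniformContinuous
  have e : Y.inner (g x) (g x) = P.ip x x := hf x x
  rw [one_mul, Y.norm_eq, norm_def, e]

/-- The extension to the completion of an inner-product preserving module map into a Hilbert
module. -/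
def PreHilbertModule.completionLift (f : E →ₗ[Aᵐᵒᵖ] Y)
    (hf : ∀ x y, Y.inner (f x) (f y) = P.inner x y) : InnerMap P.completion Y where
  toFun := Completion.extension (fun x : P.Space => f x)
  map_add' x y := by
    have hu := uniformContinuous_of_inner f hf
    have hc : Continuous (Completion.extension (fun x : P.Space => f x)) :=
      Completion.continuous_extension
    refine Completion.induction_on₂ (α := P.Space) (β := P.Space) x y (isClosed_eq
      (hc.comp (continuous_fst.add continuous_snd))
      ((hc.comp continuous_fst).add (hc.comp continuous_snd))) fun x y => ?_
    refine (congrArg _ (Completion.coe_add x y).symm).trans ?_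
    rw [Completion.extension_coe hu, Completion.extension_coe hu, Completion.extension_coe hu]
    exact f.map_add x y
  map_smul' a x := by
    have hu := uniformContinuous_of_inner f hf
    have hc : Continuous (Completion.extension (fun x : P.Space => f x)) :=
      Completion.continuous_extension
    refine Completion.induction_on (α := P.Space) x (isClosed_eq
      (hc.comp (P.completion.continuous_op_smul a))
      ((Y.continuous_op_smul a).comp hc)) fun x => ?_
    refine (congrArg _ (Completion.coe_smul a x).symm).trans ?_
    rw [Completion.extension_coe hu, Completion.extension_coe hu]
    exact f.map_smul a x
  inner_map x y := by
    have hu := uniformContinuous_of_inner f hf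
    have hc : Continuous (Completion.extension (fun x : P.Space => f x)) :=
      Completion.continuous_extension
    refine Completion.induction_on₂ (α := P.Space) (β := P.Space) x y (isClosed_eq
      ((hc.comp continuous_fst).hilbert_inner (hc.comp continuous_snd))
      (Continuous.cip P continuous_fst continuous_snd)) fun x y => ?_
    rw [Completion.extension_coe hu, Completion.extension_coe hu]
    exact (hf x y).trans (P.cip_coe x y).symm

lemma PreHilbertModule.completionLift_of (f : E →ₗ[Aᵐᵒᵖ] Y)
    (hf : ∀ x y, Y.inner (f x) (f y) = P.inner x y) (x : E) :
    completionLift f hf (P.of x) = f x :=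
  Completion.extension_coe (α := P.Space) (uniformContinuous_of_inner f hf) x

/-- A closed additive property of vectors of `X ⊗_A M` that holds on elementary tensors always
holds. -/
lemma RightHilbertModule.tensor_induction {X : RightHilbertModule A} {M : CStarCorrespondence A}
    {p : X.tensor M → Prop} (hc : IsClosed {z | p z}) (hadd : ∀ z w, p z → p w → p (z + w))
    (h : ∀ x m, p (tmul x m)) (z : X.tensor M) : p z := by
  refine PreHilbertModule.completion_induction hc (fun z => ?_) z
  induction z using TensorProduct.induction_on with
  | zero =>
    -- Zero is itself an elementary tensor, so no separate hypothesis at zero is needed.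
    have h0 := h 0 0
    rwa [tmul, TensorProduct.zero_tmul] at h0
  | add z w hz hw => rw [map_add]; exact hadd _ _ hz hw
  | tmul m x => exact h x m

lemma RightHilbertModule.inner_tmul_right {X : RightHilbertModule A} {M : CStarCorrespondence A}
    (x y : X) (m n : M) :
    (X.tensor M).inner (tmul x m) (tmul y n) = M.inner m (X.inner x y • n) :=
  (X.tensorPre M).inner_of _ _

lemma RightHilbertModule.tmul_add {X : RightHilbertModule A} {M : CStarCorrespondence A}
    (x : X) (m n : M) : (tmul x (m + n) : X.tensor M) = tmul x m + tmul x n :=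
  (congrArg _ (TensorProduct.add_tmul _ _ _)).trans (map_add _ _ _)

lemma RightHilbertModule.add_tmul {X : RightHilbertModule A} {M : CStarCorrespondence A}
    (x y : X) (m : M) : (tmul (x + y) m : X.tensor M) = tmul x m + tmul y m :=
  (congrArg _ (TensorProduct.tmul_add _ _ _)).trans (map_add _ _ _)

lemma CStarCorrespondence.norm_left_smul_le (M : CStarCorrespondence A) (a : A) (m : M) :
    ‖a • m‖ ≤ ‖a‖ * ‖m‖ := by
  -- The bound proved for pre-correspondences applies once $M$ is viewed as one; the two norms agree
  -- by `norm_eq`.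
  let P : PreCorrespondence A M := { M.pre with inner_left_smul := M.inner_left_smul }
  rw [M.norm_eq, M.norm_eq]
  exact P.norm_left_smul_le a m

lemma CStarCorrespondence.continuous_smul_left (M : CStarCorrespondence A) (m : M) :
    Continuous fun a : A => a • m :=
  (AddMonoidHomClass.lipschitz_of_bound
    (AddMonoidHom.mk' (fun a : A => a • m) fun a b => add_smul a b m) ‖m‖ fun a =>
      (M.norm_left_smul_le a m).trans_eq (mul_comm _ _)).continuous

/-- Cauchy–Schwarz in $M$ applied to $\langle x\otimes m,x\otimes m\rangle=\langle m,\langle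
x,x\rangle\cdot m\rangle$. It makes elementary tensors continuous in each factor. -/
lemma RightHilbertModule.norm_tmul_le {X : RightHilbertModule A} {M : CStarCorrespondence A}
    (x : X) (m : M) : ‖(tmul x m : X.tensor M)‖ ≤ ‖x‖ * ‖m‖ := by
  have h : ‖X.inner x x • m‖ ≤ ‖x‖ ^ 2 * ‖m‖ := by
    rw [X.norm_eq x, Real.sq_sqrt (norm_nonneg _)]
    exact M.norm_left_smul_le _ _
  have h' : ‖M.inner m (X.inner x x • m)‖ ≤ ‖m‖ * ‖X.inner x x • m‖ := by
    rw [M.norm_eq, M.norm_eq]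
    exact M.pre.norm_inner_le _ _
  rw [(X.tensor M).norm_eq, inner_tmul_right]
  refine Real.sqrt_le_iff.2 ⟨by positivity, h'.trans ?_⟩
  nlinarith [norm_nonneg m]

lemma RightHilbertModule.continuous_tmul_left {X : RightHilbertModule A}
    {M : CStarCorrespondence A} (m : M) : Continuous fun x : X => (tmul x m : X.tensor M) :=
  (AddMonoidHomClass.lipschitz_of_bound
    (AddMonoidHom.mk' (fun x : X => (tmul x m : X.tensor M)) fun x y => add_tmul x y m) ‖m‖
      fun x => (norm_tmul_le x m).trans_eq (mul_comm _ _)).continuous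

lemma RightHilbertModule.continuous_tmul_right {X : RightHilbertModule A}
    {M : CStarCorrespondence A} (x : X) : Continuous fun m : M => (tmul x m : X.tensor M) :=
  (AddMonoidHomClass.lipschitz_of_bound
    (AddMonoidHom.mk' (fun m : M => (tmul x m : X.tensor M)) fun m n => tmul_add x m n) ‖x‖
      fun m => norm_tmul_le x m).continuous

end CompletionLift

/-! ### The universal property of the direct limit -/

section LimitLift

variable {A : Type u} [CStarAlgebra A] [PartialOrder A] [StarOrderedRing A]
  {X : ℕ → RightHilbertModule A} {T : ∀ k, InnerMap (X k) (X (k + 1))} {Y : RightHilbertModule A}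

/-- A closed property of vectors of the direct limit that holds on the images of the canonical maps
always holds. -/
lemma limit_induction {p : limitModule X T → Prop} (hc : IsClosed {z | p z})
    (h : ∀ k x, p (limitMap X T k x)) (z : limitModule X T) : p z := by
  refine PreHilbertModule.completion_induction hc (fun z => ?_) z
  induction z using DirectLimit.induction with
  | ih k x => exact h k x

lemma apply_transition (g : ∀ k, InnerMap (X k) Y) (hg : ∀ k x, g (k + 1) (T k x) = g k x) (i j : ℕ) (h : i ≤ j) (x : X i) :
    g i x = g j (transition X T i j h x) := by
  induction j, h using Nat.le_induction with
  | base => rw [transition_self]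
  | succ n hn ih => rw [transition_succ X T _ _ hn, hg, ← ih]

/-- The map out of the direct limit defined by a compatible family of maps. -/
def limitLift (g : ∀ k, InnerMap (X k) Y) (hg : ∀ k x, g (k + 1) (T k x) = g k x) :
    InnerMap (limitModule X T) Y :=
  PreHilbertModule.completionLift (P := algLimitPre X T)
    { toFun := DirectLimit.lift (transition X T) (fun k x => g k x) (apply_transition g hg)
      map_add' := fun x y => by
        induction x, y using DirectLimit.induction₂ with
        | ih i x y =>
          rw [DirectLimit.add_def]
          exact map_add (g i) x y
      map_smul' := fun a x => by
        induction x using DirectLimit.induction with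
        | ih i x =>
          rw [DirectLimit.smul_def]
          exact map_smul (g i) a x }
    (fun x y => by
      induction x, y using DirectLimit.induction₂ with
      | ih i x y =>
        exact ((g i).inner_apply x y).trans (DirectLimit.lift₂_def (transition X T)
          (transition X T) (fun k x y => (X k).inner x y)
          (fun i j h x y => ((transition X T i j h).inner_apply x y).symm) i x y).symm)

lemma limitLift_limitMap (g : ∀ k, InnerMap (X k) Y)
    (hg : ∀ k x, g (k + 1) (T k x) = g k x) (k : ℕ) (x : X k) :
    limitLift g hg (limitMap X T k x) = g k x :=
  PreHilbertModule.completionLift_of _ _ _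

end LimitLift

/-! ### Existence and uniqueness of $R$ and $Q$ -/

section Realization

variable {A : Type u} [CStarAlgebra A] [PartialOrder A] [StarOrderedRing A]

lemma InnerMap.tensorId_comp {X Y Z : RightHilbertModule A} (g : InnerMap Y Z) (f : InnerMap X Y)
    (M : CStarCorrespondence A) (z : X.tensor M) :
    g.tensorId M (f.tensorId M z) = (g.comp f).tensorId M z :=
  DFunLike.congr_fun (tensor_ext (f := (g.tensorId M).comp (f.tensorId M))
    (g := (g.comp f).tensorId M) fun x m => by simp) z

variable {M : CStarCorrespondence A} {m : M} {hm : M.inner m m = 1}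

lemma filterLimitMap_tensorIdPow (k : ℕ) (z : (RightHilbertModule.self A).tensorPow M k) :
    filterLimitMap M m hm (k + 1) ((filterMap M m hm).tensorIdPow k z) =
      filterLimitMap M m hm k z :=
  limitMap_comp _ _ k z

lemma filterLimit_induction {p : filterLimit M m hm → Prop} (hc : IsClosed {z | p z})
    (h : ∀ k x, p (filterLimitMap M m hm k x)) (z : filterLimit M m hm) : p z :=
  limit_induction hc h z

/-- Each $\iota^k(z)$ is also $\iota^{k+1}(m\otimes z)$, so degree zero can be skipped. This suits
$R$, whose values are prescribed only on the images of the $\iota^{k+1}$. -/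
lemma filterLimit_induction_succ {p : filterLimit M m hm → Prop} (hc : IsClosed {z | p z})
    (h : ∀ k x, p (filterLimitMap M m hm (k + 1) x)) (z : filterLimit M m hm) : p z :=
  filterLimit_induction hc (fun k x => filterLimitMap_tensorIdPow (hm := hm) k x ▸ h k _) z

variable (M m hm) in
/-- The map `ι^k ⊗ id`, regarded as a map on `M^{⊗ k + 1}`, composed for `k = 0` with the first
structure map. -/
def filterShift : ∀ k, InnerMap ((RightHilbertModule.self A).tensorPow M k)
    ((filterLimit M m hm).tensor M)
  | 0 => ((filterLimitMap M m hm 0).tensorId M).comp (filterMap M m hm)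
  | k + 1 => (filterLimitMap M m hm k).tensorId M

/-- In degree zero this is how `filterShift` was defined; in higher degrees it is the compatibility
of the $\iota^k$, tensored with the identity of $M$. -/
lemma filterShift_tensorIdPow (k : ℕ) (z : (RightHilbertModule.self A).tensorPow M k) :
    filterShift M m hm (k + 1) ((filterMap M m hm).tensorIdPow k z) = filterShift M m hm k z := by
  cases k with
  | zero => rfl
  | succ k =>
    refine (InnerMap.tensorId_comp (filterLimitMap M m hm (k + 1))
      ((filterMap M m hm).tensorIdPow k) M z).trans ?_
    have : (filterLimitMap M m hm (k + 1)).comp ((filterMap M m hm).tensorIdPow k) =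
        filterLimitMap M m hm k := InnerMap.ext (filterLimitMap_tensorIdPow k)
    rw [this]
    rfl

variable (M m hm) in
/-- The inner-product preserving map `R : M_∞ → M_∞ ⊗_A M` such that
`R ∘ ι^{k+1} = ι^k ⊗ id`. -/
def filterLimitShift : InnerMap (filterLimit M m hm) ((filterLimit M m hm).tensor M) :=
  limitLift (filterShift M m hm) filterShift_tensorIdPow

lemma filterLimitShift_apply (k : ℕ) (z : (RightHilbertModule.self A).tensorPow M (k + 1)) :
    filterLimitShift M m hm (filterLimitMap M m hm (k + 1) z) =
      (filterLimitMap M m hm k).tensorId M z :=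
  limitLift_limitMap (filterShift M m hm) filterShift_tensorIdPow (k + 1) z

/-- The closed range contains $\iota^k(x)\otimes n=R(\iota^{k+1}(x\otimes n))$. Density of the
$\iota^k(x)$ in the first factor then gives all elementary tensors. -/
lemma filterLimitShift_surjective : Function.Surjective (filterLimitShift M m hm) := by
  refine tensor_induction (p := fun z => z ∈ Set.range (filterLimitShift M m hm))
    (filterLimitShift M m hm).isClosed_range ?_ fun x n => ?_
  · rintro _ _ ⟨z, rfl⟩ ⟨w, rfl⟩
    exact ⟨z + w, map_add _ _ _⟩
  · refine filterLimit_induction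
      (p := fun x => tmul x n ∈ Set.range (filterLimitShift M m hm))
      ((filterLimitShift M m hm).isClosed_range.preimage (continuous_tmul_left n))
      (fun k x => ⟨filterLimitMap M m hm (k + 1) (tmul x n), ?_⟩) x
    exact (filterLimitShift_apply k (tmul x n)).trans (InnerMap.tensorId_tmul _ _ _ _)

variable {X : RightHilbertModule A}

/-- The inner-product preserving map `a ↦ φ · a`. -/
def InnerMap.ofUnit (φ : X) (hφ : X.inner φ φ = 1) :
    InnerMap (RightHilbertModule.self A) X where
  toFun a := φ <• (show A from a)
  map_add' a b := by
    change φ <• ((show A from a) + (show A from b)) = _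
    rw [MulOpposite.op_add, add_smul]
  map_smul' b a := by
    change φ <• ((show A from a) * b.unop) = _
    rw [MulOpposite.op_mul, mul_smul]
    rfl
  inner_map a b := by
    change X.inner (φ <• (show A from a)) (φ <• (show A from b)) =
      star (show A from a) * (show A from b)
    have h : X.inner (φ <• (show A from a)) φ = star (show A from a) * X.inner φ φ :=
      X.pre.inner_smul_left _ _ _
    rw [X.inner_smul_right, h, hφ, mul_one]

/-- The maps `q_k : M^{⊗ k} → X` with `q_0 (a) = φ · a` and `D ∘ q_{k+1} = q_k ⊗ id`. -/
def realizationMap (D : InnerEquiv X (X.tensor M)) (φ : X) (hφ : X.inner φ φ = 1) :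
    ∀ k, InnerMap ((RightHilbertModule.self A).tensorPow M k) X
  | 0 => InnerMap.ofUnit φ hφ
  | k + 1 => D.symm.toInnerMap.comp ((realizationMap D φ hφ k).tensorId M)

lemma apply_realizationMap_succ (D : InnerEquiv X (X.tensor M)) (φ : X) (hφ : X.inner φ φ = 1)
    (k : ℕ) (z : (RightHilbertModule.self A).tensorPow M (k + 1)) :
    D (realizationMap D φ hφ (k + 1) z) = (realizationMap D φ hφ k).tensorId M z :=
  D.apply_symm_apply _

lemma realizationMap_selfOne (D : InnerEquiv X (X.tensor M)) (φ : X) (hφ : X.inner φ φ = 1) :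
    realizationMap D φ hφ 0 (selfOne A) = φ := by
  change φ <• (1 : A) = φ
  rw [MulOpposite.op_one, one_smul]

/-- After applying the injective map $D$, degree zero reads $\phi\otimes(m\cdot a)=D(\phi\cdot a)$,
the scaling equation. In degree $k+1$ both sides are tensored forms of the statement in degree $k$.
-/
lemma realizationMap_tensorIdPow {D : InnerEquiv X (X.tensor M)} {φ : X}
    (h : IsScalingFunction m D φ) (k : ℕ) (z : (RightHilbertModule.self A).tensorPow M k) :
    realizationMap D φ h.1 (k + 1) ((filterMap M m hm).tensorIdPow k z) =
      realizationMap D φ h.1 k z := by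
  induction k with
  | zero =>
    refine EquivLike.injective D ?_
    refine (apply_realizationMap_succ D φ h.1 0 _).trans ?_
    change (realizationMap D φ h.1 0).tensorId M (tmul (selfOne A) (m <• (show A from z))) =
      D (φ <• (show A from z))
    refine (InnerMap.tensorId_tmul (realizationMap D φ h.1 0) M _ _).trans ?_
    rw [realizationMap_selfOne, tmul_smul, ← h.2]
    exact (map_smul D.toInnerMap _ _).symm
  | succ k ih =>
    refine EquivLike.injective D ?_
    refine (apply_realizationMap_succ D φ h.1 (k + 1) _).trans
      (Eq.trans ?_ (apply_realizationMap_succ D φ h.1 k z).symm)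
    refine (InnerMap.tensorId_comp (realizationMap D φ h.1 (k + 1))
      ((filterMap M m hm).tensorIdPow k) M z).trans ?_
    have : (realizationMap D φ h.1 (k + 1)).comp ((filterMap M m hm).tensorIdPow k) =
        realizationMap D φ h.1 k := InnerMap.ext ih
    rw [this]

lemma exists_isRealization {D : InnerEquiv X (X.tensor M)} {φ : X}
    (h : IsScalingFunction m D φ) :
    ∃ R Q, IsRealization (hm := hm) D φ R Q := by
  let Q : InnerMap (filterLimit M m hm) X :=
    limitLift (realizationMap D φ h.1) (realizationMap_tensorIdPow h)
  have hQ : ∀ k z, Q (filterLimitMap M m hm k z) = realizationMap D φ h.1 k z :=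
    limitLift_limitMap _ _
  refine ⟨(filterLimitShift M m hm).equivOfSurjective filterLimitShift_surjective, Q,
    filterLimitShift_apply, ?_, ?_⟩
  · exact (hQ 0 (selfOne A)).trans (realizationMap_selfOne D φ h.1)
  · refine filterLimit_induction_succ (isClosed_eq
      (D.isometry.continuous.comp Q.isometry.continuous)
      ((Q.tensorId M).isometry.continuous.comp
        (filterLimitShift M m hm).isometry.continuous)) fun k x => ?_
    rw [hQ, apply_realizationMap_succ]
    change _ = Q.tensorId M (filterLimitShift M m hm _)
    rw [filterLimitShift_apply]
    refine Eq.trans ?_ (InnerMap.tensorId_comp Q (filterLimitMap M m hm k) M x).symm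
    rw [show Q.comp (filterLimitMap M m hm k) = realizationMap D φ h.1 k from
      InnerMap.ext (hQ k)]

namespace IsRealization

variable {D : InnerEquiv X (X.tensor M)} {φ : X}
  {R : InnerEquiv (filterLimit M m hm) ((filterLimit M m hm).tensor M)}
  {Q : InnerMap (filterLimit M m hm) X}

/-- The normalization determines $Q\circ\iota^0$ by $A$-linearity, and the intertwining relation
together with injectivity of $D$ determines $Q\circ\iota^{k+1}$ from $Q\circ\iota^k$. This is the
uniqueness of $Q$. -/
lemma apply_limitMap (h : IsRealization D φ R Q) (hφ : X.inner φ φ = 1) (k : ℕ)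
    (z : (RightHilbertModule.self A).tensorPow M k) :
    Q (filterLimitMap M m hm k z) = realizationMap D φ hφ k z := by
  induction k with
  | zero =>
    let a : A := z
    have e : z = (MulOpposite.op a • selfOne A : RightHilbertModule.self A) := (one_mul a).symm
    have hs : (Q.comp (filterLimitMap M m hm 0)) (MulOpposite.op a • selfOne A) =
        realizationMap D φ hφ 0 (MulOpposite.op a • selfOne A) := by
      refine (map_smul (Q.comp (filterLimitMap M m hm 0)) (MulOpposite.op a) (selfOne A)).trans
        (Eq.trans ?_ (map_smul (realizationMap D φ hφ 0) (MulOpposite.op a) (selfOne A)).symm)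
      exact congrArg _ (h.base.trans (realizationMap_selfOne D φ hφ).symm)
    rw [e]
    exact hs
  | succ k ih =>
    refine EquivLike.injective D ?_
    rw [h.intertwine, h.shift, apply_realizationMap_succ]
    refine (InnerMap.tensorId_comp Q (filterLimitMap M m hm k) M z).trans ?_
    rw [show Q.comp (filterLimitMap M m hm k) = realizationMap D φ hφ k from InnerMap.ext ih]

end IsRealization

theorem existsUnique_isRealization {D : InnerEquiv X (X.tensor M)} {φ : X}
    (h : IsScalingFunction m D φ) :
    ∃! p : InnerEquiv (filterLimit M m hm) ((filterLimit M m hm).tensor M) ×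
      InnerMap (filterLimit M m hm) X, IsRealization D φ p.1 p.2 := by
  obtain ⟨R, Q, hRQ⟩ := exists_isRealization (hm := hm) h
  refine ⟨(R, Q), hRQ, fun p hp => Prod.ext ?_ ?_⟩
  -- $R$ is determined by the shift relation alone, without reference to $Q$.
  · refine InnerEquiv.ext (filterLimit_induction_succ (isClosed_eq
      p.1.isometry.continuous R.isometry.continuous) fun k x => ?_)
    rw [hp.shift, hRQ.shift]
  · refine InnerMap.ext (filterLimit_induction (isClosed_eq
      p.2.isometry.continuous Q.isometry.continuous) fun k x => ?_)
    rw [hp.apply_limitMap h.1, hRQ.apply_limitMap h.1]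

end Realization

/-! ### Unconditional sums of positive elements -/

section PositiveSums

variable {A : Type*} [CStarAlgebra A] [PartialOrder A] [StarOrderedRing A]

/-- A family of positive elements of a C*-algebra sums to an upper bound of its finite partial sums
that is approximated by them. -/
lemma hasSum_of_nonneg_of_approx {ι : Type*} {f : ι → A} {c : A} (hf : ∀ i, 0 ≤ f i)
    (hle : ∀ s : Finset ι, ∑ i ∈ s, f i ≤ c)
    (happrox : ∀ ε : ℝ, 0 < ε → ∃ s : Finset ι, ‖c - ∑ i ∈ s, f i‖ < ε) : HasSum f c := by
  classical
  rw [HasSum, SummationFilter.unconditional_filter, Metric.tendsto_atTop]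
  intro ε hε
  obtain ⟨s, hs⟩ := happrox ε hε
  refine ⟨s, fun t hst => ?_⟩
  rw [dist_comm, dist_eq_norm]
  refine (CStarAlgebra.norm_le_norm_of_nonneg_of_le (sub_nonneg.2 (hle t)) ?_).trans_lt hs
  exact sub_le_sub_left (Finset.sum_le_sum_of_subset_of_nonneg hst fun i _ _ => hf i) c

lemma HasSum.exists_norm_sub_lt {ι : Type*} {f : ι → A} {c : A} (h : HasSum f c) {ε : ℝ}
    (hε : 0 < ε) : ∃ s : Finset ι, ‖c - ∑ i ∈ s, f i‖ < ε := by
  classical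
  rw [HasSum, SummationFilter.unconditional_filter, Metric.tendsto_atTop] at h
  obtain ⟨s, hs⟩ := h ε hε
  refine ⟨s, ?_⟩
  have := hs s le_rfl
  rwa [dist_comm, dist_eq_norm] at this

/-- For positive elements of a C*-algebra, a convergent iterated sum is a double sum. -/
lemma HasSum.prod_of_nonneg {ι κ : Type*} {f : ι × κ → A} {b : ι → A} {c : A} (hf : ∀ p, 0 ≤ f p)
    (hb : ∀ i, HasSum (fun j => f (i, j)) (b i)) (hc : HasSum b c) : HasSum f c := by
  classical
  have hb0 : ∀ i, 0 ≤ b i := fun i => (hb i).nonneg fun j => hf (i, j)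
  refine hasSum_of_nonneg_of_approx hf (fun s => ?_) fun ε hε => ?_
  · calc ∑ p ∈ s, f p ≤ ∑ p ∈ s.image Prod.fst ×ˢ s.image Prod.snd, f p :=
          Finset.sum_le_sum_of_subset_of_nonneg Finset.subset_product fun p _ _ => hf p
      _ = ∑ i ∈ s.image Prod.fst, ∑ j ∈ s.image Prod.snd, f (i, j) := Finset.sum_product _ _ _
      _ ≤ ∑ i ∈ s.image Prod.fst, b i :=
          Finset.sum_le_sum fun i _ => sum_le_hasSum _ (fun j _ => hf (i, j)) (hb i)
      _ ≤ c := sum_le_hasSum _ (fun i _ => hb0 i) hc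
  · obtain ⟨s, hs⟩ := hc.exists_norm_sub_lt (half_pos hε)
    -- Half of the error goes to the outer sum; the other half is shared among the `s.card` inner
    -- sums, with one added to keep the denominator positive when `s` is empty.
    have hδ : 0 < ε / 2 / (s.card + 1) := by positivity
    choose t ht using fun i => (hb i).exists_norm_sub_lt hδ
    refine ⟨s.sigma t |>.map (Equiv.sigmaEquivProd ι κ).toEmbedding, ?_⟩
    rw [Finset.sum_map, Finset.sum_sigma]
    change ‖c - ∑ i ∈ s, ∑ j ∈ t i, f (i, j)‖ < ε
    have h1 : ‖∑ i ∈ s, (b i - ∑ j ∈ t i, f (i, j))‖ ≤ s.card * (ε / 2 / (s.card + 1)) := by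
      refine (norm_sum_le_of_le s fun i _ => (ht i).le).trans_eq ?_
      rw [Finset.sum_const, nsmul_eq_mul]
    have h2 : s.card * (ε / 2 / (s.card + 1)) ≤ ε / 2 := by
      rw [mul_div_assoc', div_le_iff₀ (by positivity)]
      nlinarith
    have e : c - ∑ i ∈ s, ∑ j ∈ t i, f (i, j) =
        (c - ∑ i ∈ s, b i) + ∑ i ∈ s, (b i - ∑ j ∈ t i, f (i, j)) := by
      rw [Finset.sum_sub_distrib]; abel
    rw [e]
    linarith [norm_add_le (c - ∑ i ∈ s, b i) (∑ i ∈ s, (b i - ∑ j ∈ t i, f (i, j)))]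

end PositiveSums

/-! ### Parseval identities as sums of positive forms -/

section FormSums

namespace PreHilbertModule

variable {A E : Type u} [CStarAlgebra A] [PartialOrder A] [AddCommGroup E]
  [Module ℂ E] [Module Aᵐᵒᵖ E] [IsScalarTower ℂ Aᵐᵒᵖ E] (P : PreHilbertModule A E)

lemma polarization (x y : E) :
    P.inner x y = (4⁻¹ : ℂ) • (P.inner (x + y) (x + y) - P.inner (x - y) (x - y)
      - Complex.I • P.inner (x + Complex.I • y) (x + Complex.I • y)
      + Complex.I • P.inner (x - Complex.I • y) (x - Complex.I • y)) := by
  simp only [inner_add_left, inner_sub_left, inner_sub_right, inner_csmul_left,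
    inner_csmul_right, P.inner_add_right, Complex.star_def, Complex.conj_I, smul_add, smul_sub,
    smul_smul]
  match_scalars <;> ring_nf <;> simp only [Complex.I_sq] <;> norm_num

/-- The rank-one form `⟨x, y⟩ = t(x)* t(y)` defined by a functional `t`. -/
def ofFunctional [StarOrderedRing A] (t : E →ₗ[Aᵐᵒᵖ] A) : PreHilbertModule A E where
  inner x y := star (t x) * t y
  inner_add_right x y z := by rw [map_add, mul_add]
  inner_smul_right x y a := by
    rw [map_smul, MulOpposite.smul_eq_mul_unop, MulOpposite.unop_op, mul_assoc]
  star_inner x y := by rw [star_mul, star_star]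
  inner_self_nonneg x := star_mul_self_nonneg _

/-- The form `P - ∑ᵢ Pᵢ`, if it is positive. -/
def subSum [IsOrderedAddMonoid A] {ι : Type*} (Q : ι → PreHilbertModule A E) (s : Finset ι)
    (h : ∀ x, ∑ i ∈ s, (Q i).inner x x ≤ P.inner x x) : PreHilbertModule A E where
  inner x y := P.inner x y - ∑ i ∈ s, (Q i).inner x y
  inner_add_right x y z := by
    simp only [P.inner_add_right, fun i => (Q i).inner_add_right, Finset.sum_add_distrib]
    abel
  inner_smul_right x y a := by
    simp only [P.inner_smul_right, fun i => (Q i).inner_smul_right, ← Finset.sum_mul, sub_mul]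
  star_inner x y := by
    simp only [star_sub, star_sum, P.star_inner, fun i => (Q i).star_inner]
  inner_self_nonneg x := sub_nonneg.2 (h x)

/-- By polarization, off-diagonal values are fixed linear combinations of four diagonal ones. -/
lemma hasSum_inner {ι : Type*} {Q : ι → PreHilbertModule A E} {P : PreHilbertModule A E}
    (h : ∀ x, HasSum (fun i => (Q i).inner x x) (P.inner x x)) (x y : E) :
    HasSum (fun i => (Q i).inner x y) (P.inner x y) := by
  rw [P.polarization]
  simp only [fun i => (Q i).polarization x y]
  exact ((((h _).sub (h _)).sub ((h _).const_smul _)).add ((h _).const_smul _)).const_smul _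

end PreHilbertModule

variable {A : Type u} [CStarAlgebra A] [PartialOrder A] [StarOrderedRing A]

/-- If a family of continuous positive forms sums to the inner product on a dense set of vectors,
then it does so everywhere. -/
lemma RightHilbertModule.hasSum_inner_of_dense {X : RightHilbertModule A} {ι : Type*}
    {Q : ι → PreHilbertModule A X} (hQ : ∀ i, Continuous fun x => (Q i).inner x x)
    (h : Dense {x | HasSum (fun i => (Q i).inner x x) (X.inner x x)}) (x : X) :
    HasSum (fun i => (Q i).inner x x) (X.inner x x) := by
  have hX : Continuous fun x => X.inner x x := continuous_id.hilbert_inner continuous_id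
  -- Bessel's inequality is a closed condition for each finite set, so it extends from the dense set
  -- to all vectors.
  have hbessel : ∀ (s : Finset ι) x, ∑ i ∈ s, (Q i).inner x x ≤ X.inner x x := by
    intro s x
    have hcl : IsClosed {x | ∑ i ∈ s, (Q i).inner x x ≤ X.inner x x} :=
      isClosed_le (continuous_finsetSum _ fun i _ => hQ i) hX
    refine hcl.closure_subset_iff.2 (fun y hy => ?_) (h x)
    exact sum_le_hasSum s (fun i _ => (Q i).inner_self_nonneg y) hy
  refine hasSum_of_nonneg_of_approx (fun i => (Q i).inner_self_nonneg x)
    (fun s => hbessel s x) fun ε hε => ?_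
  have hδ : 0 < √ε / 2 := by positivity
  obtain ⟨w, hw, hxw⟩ := h.exists_dist_lt x hδ
  obtain ⟨s, hs⟩ := HasSum.exists_norm_sub_lt hw (sq_pos_of_pos hδ)
  refine ⟨s, ?_⟩
  -- The remainder of the partial sum is itself a positive form, so its square-root length obeys the
  -- triangle inequality. That length is small at $w$ by the choice of `s`, and small at $x-w$
  -- because it is dominated by the norm of $X$.
  let G : PreHilbertModule A X := X.pre.subSum Q s (hbessel s)
  have h1 : √‖G.inner w w‖ < √ε / 2 := (Real.sqrt_lt' hδ).2 hs
  have h2 : √‖G.inner (x - w) (x - w)‖ < √ε / 2 := by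
    refine lt_of_le_of_lt ?_ hxw
    rw [dist_eq_norm, X.norm_eq]
    refine Real.sqrt_le_sqrt
      (CStarAlgebra.norm_le_norm_of_nonneg_of_le (G.inner_self_nonneg _) ?_)
    exact sub_le_self _ (Finset.sum_nonneg fun i _ => (Q i).inner_self_nonneg _)
  have h3 : √‖G.inner x x‖ ≤ √‖G.inner w w‖ + √‖G.inner (x - w) (x - w)‖ := by
    have := norm_add_le (show G.Space from w) (show G.Space from x - w)
    have e : (show G.Space from w) + (show G.Space from x - w) = (show G.Space from x) :=
      add_sub_cancel w x
    rw [e] at this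
    exact this
  have h4 : √‖G.inner x x‖ < √ε := by linarith
  exact (Real.sqrt_lt_sqrt_iff (norm_nonneg _)).1 h4

/-- The functional `y ↦ ⟨x, y⟩`. -/
def RightHilbertModule.coeff {X : RightHilbertModule A} (x : X) : X →ₗ[Aᵐᵒᵖ] A where
  toFun y := X.inner x y
  map_add' y z := X.inner_add_right x y z
  map_smul' a y := X.inner_smul_right x y a.unop

@[simp] lemma RightHilbertModule.coeff_apply {X : RightHilbertModule A} (x y : X) :
    coeff x y = X.inner x y := rfl

/-- If `(e i)` satisfies the Parseval identity on a dense set of vectors in the range of `f`, then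
it does so on the range of `f`. -/
lemma InnerMap.hasSum_of_dense {Z X : RightHilbertModule A} (f : InnerMap Z X) {ι : Type*}
    (e : ι → X) (h : Dense {z | HasSum (fun i => X.inner (f z) (e i) * X.inner (e i) (f z))
      (Z.inner z z)}) (z : Z) :
    HasSum (fun i => X.inner (f z) (e i) * X.inner (e i) (f z)) (Z.inner z z) := by
  let Q : ι → PreHilbertModule A Z := fun i =>
    PreHilbertModule.ofFunctional ((coeff (e i)).comp f.toLinearMap)
  have hQ : ∀ i x y, (Q i).inner x y = X.inner (f x) (e i) * X.inner (e i) (f y) := fun i x y =>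
    congrArg (· * X.inner (e i) (f y)) (X.star_inner (e i) (f x))
  simp only [← hQ] at h ⊢
  refine hasSum_inner_of_dense (fun i => ?_) h z
  simp only [hQ]
  exact (f.isometry.continuous.hilbert_inner continuous_const).mul
    (continuous_const.hilbert_inner f.isometry.continuous)

/-- The map `M ⊙ Z → M`, `n ⊗ z ↦ ⟨x, f(z)⟩ · n`. -/
def InnerMap.contract {Z X : RightHilbertModule A} (f : InnerMap Z X) (M : CStarCorrespondence A)
    (x : X) : M ⊗[ℂ] Z →ₗ[ℂ] M :=
  TensorProduct.lift <| LinearMap.mk₂ ℂ (fun (n : M) (z : Z) => X.inner x (f z) • n)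
    (fun n n' z => smul_add _ _ _)
    (fun c n z => smul_comm _ _ _)
    (fun n z z' => by rw [map_add, X.inner_add_right, add_smul])
    (fun c n z => by
      have h : X.inner x (c • f z) = c • X.inner x (f z) := X.pre.inner_csmul_right _ _ _
      rw [f.map_complex_smul, h, smul_assoc])

@[simp] lemma InnerMap.contract_tmul {Z X : RightHilbertModule A} (f : InnerMap Z X)
    (M : CStarCorrespondence A) (x : X) (n : M) (z : Z) :
    f.contract M x (n ⊗ₜ z) = X.inner x (f z) • n := rfl

/-- Pairing with $x\otimes n$ can be done in two stages: contract with $x$ first, then pair with $n$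
inside $M$. The frame of $M$ can thus be applied to the contraction for each fixed $x$. -/
lemma InnerMap.inner_tmul_tensorId_of {Z X : RightHilbertModule A} (f : InnerMap Z X)
    (M : CStarCorrespondence A) (x : X) (n : M) (z : M ⊗[ℂ] Z) :
    (X.tensor M).inner (tmul x n) (f.tensorId M ((Z.tensorPre M).of z)) =
      M.inner n (f.contract M x z) := by
  induction z using TensorProduct.induction_on with
  | zero =>
    rw [map_zero, map_zero]
    refine Eq.trans ?_ (M.pre.inner_zero_right n).symm
    refine (congrArg _ (map_zero (f.tensorId M))).trans ((X.tensor M).pre.inner_zero_right _)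
  | add z w hz hw =>
    rw [map_add, map_add, M.inner_add_right, ← hz, ← hw]
    refine (congrArg _ (map_add (f.tensorId M) _ _)).trans ((X.tensor M).inner_add_right _ _ _)
  | tmul m z =>
    change (X.tensor M).inner (tmul x n) (f.tensorId M (tmul z m)) = _
    rw [InnerMap.tensorId_tmul, inner_tmul_right, contract_tmul]

/-- If `(e i)` satisfies the Parseval identity on the range of `f` and `(m j)` is a Parseval frame
for `M`, then `(e i ⊗ m j)` satisfies the Parseval identity on the range of `f ⊗ id`. -/
theorem InnerMap.hasSum_tensorId {Z X : RightHilbertModule A} (f : InnerMap Z X)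
    {M : CStarCorrespondence A} {ι κ : Type*} {e : ι → X} {m : κ → M}
    (he : ∀ z, HasSum (fun i => X.inner (f z) (e i) * X.inner (e i) (f z)) (Z.inner z z))
    (hm : ∀ n, HasSum (fun j => M.inner n (m j) * M.inner (m j) n) (M.inner n n))
    (w : Z.tensor M) :
    HasSum (fun p : ι × κ => (X.tensor M).inner (f.tensorId M w) (tmul (e p.1) (m p.2)) *
      (X.tensor M).inner (tmul (e p.1) (m p.2)) (f.tensorId M w)) ((Z.tensor M).inner w w) := by
  let Q : ι → PreHilbertModule A Z := fun i =>
    PreHilbertModule.ofFunctional ((coeff (e i)).comp f.toLinearMap)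
  have hQ : ∀ i x y, (Q i).inner x y = X.inner (f x) (e i) * X.inner (e i) (f y) := fun i x y =>
    congrArg (· * X.inner (e i) (f y)) (X.star_inner (e i) (f x))
  -- A general tensor is a sum of elementary ones, so the identity is needed for pairs of distinct
  -- vectors as well.
  have hpol : ∀ x y, HasSum (fun i => X.inner (f x) (e i) * X.inner (e i) (f y))
      (Z.inner x y) := by
    intro x y
    simp only [← hQ] at he ⊢
    exact PreHilbertModule.hasSum_inner (P := Z.pre) he x y
  -- Both sides are biadditive, so elementary tensors suffice. There the sum is the image of the one
  -- in `hpol` under the continuous additive map $a\mapsto\langle n,a\cdot n'\rangle$.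
  have hcontract : ∀ z w : M ⊗[ℂ] Z, HasSum
      (fun i => M.inner (f.contract M (e i) z) (f.contract M (e i) w)) (Z.tensorForm M z w) := by
    intro z w
    have hr : ∀ n z w, M.inner n (z + w) = M.inner n z + M.inner n w := M.inner_add_right
    have hl : ∀ z w n, M.inner (z + w) n = M.inner z n + M.inner w n := M.pre.inner_add_left
    have hzr : ∀ n, M.inner n 0 = 0 := M.pre.inner_zero_right
    have hzl : ∀ n, M.inner 0 n = 0 := M.pre.inner_zero_left
    induction z using TensorProduct.induction_on with
    | zero => simpa only [map_zero, LinearMap.zero_apply, hzl] using hasSum_zero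
    | add z z' hz hz' =>
      simpa only [map_add, LinearMap.add_apply, hl] using hz.add hz'
    | tmul n z =>
      induction w using TensorProduct.induction_on with
      | zero => simpa only [map_zero, hzr] using hasSum_zero
      | add w w' hw hw' => simpa only [map_add, hr] using hw.add hw'
      | tmul n' z' =>
        let g : A →+ A := AddMonoidHom.mk' (fun a => M.inner n (a • n')) fun a b => by
          rw [add_smul, M.inner_add_right]
        have hg : Continuous g :=
          Continuous.hilbert_inner (Y := M.toRightHilbertModule) continuous_const
            (M.continuous_smul_left n')
        refine Eq.mp ?_ ((hpol z z').map g hg)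
        congr 1
        funext i
        change M.inner n ((X.inner (f z) (e i) * X.inner (e i) (f z')) • n') =
          M.inner (X.inner (e i) (f z) • n) (X.inner (e i) (f z') • n')
        rw [M.inner_left_smul, X.star_inner, smul_smul]
  refine (f.tensorId M).hasSum_of_dense (fun p : ι × κ => tmul (e p.1) (m p.2)) ?_ w
  refine fun w => PreHilbertModule.completion_induction (P := Z.tensorPre M) isClosed_closure
    (fun z => subset_closure ?_) w
  -- For fixed `i`, the sum over the frame of $M$ is its Parseval identity at the contraction with
  -- `e i`; summing the results over `i` is `hcontract`. Positivity of the terms merges the two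
  -- sums.
  refine HasSum.prod_of_nonneg (b := fun i => M.inner (f.contract M (e i) z) (f.contract M (e i) z))
    (fun p => ?_) (fun i => ?_) ?_
  · rw [← (X.tensor M).star_inner (tmul (e p.1) (m p.2))]
    exact star_mul_self_nonneg _
  · refine Eq.mp ?_ (hm (f.contract M (e i) z))
    congr 1
    funext j
    change _ = (X.tensor M).inner (f.tensorId M ((Z.tensorPre M).of z)) (tmul (e i) (m j)) *
      (X.tensor M).inner (tmul (e i) (m j)) (f.tensorId M ((Z.tensorPre M).of z))
    rw [← (X.tensor M).star_inner (tmul (e i) (m j)), f.inner_tmul_tensorId_of, M.star_inner]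
  · exact (PreHilbertModule.inner_of (Z.tensorPre M) z z).symm ▸ hcontract z z

end FormSums

/-! ### The index set of the frame and the bijection given by appending an entry -/

namespace FrameIndex

variable {J : Type*} {j₀ : J}

open Classical in
/-- Appending an entry to a tuple; the empty tuple stands for all tuples `(j₀, …, j₀)`. -/
def step : FrameIndex j₀ → J → FrameIndex j₀
  | none, j => if h : j = j₀ then none else some ⟨0, fun _ => j, h⟩
  | some ⟨k, j⟩, l => some ⟨k + 1, Fin.snoc (α := fun _ => J) j.1 l, by
      have : (0 : Fin (k + 2)) = (0 : Fin (k + 1)).castSucc := rfl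
      rw [this, Fin.snoc_castSucc]
      exact j.2⟩

/-- The length of a tuple. -/
def length : FrameIndex j₀ → ℕ
  | none => 0
  | some ⟨k, _⟩ => k + 1

@[simp] lemma step_none_self : step (none : FrameIndex j₀) j₀ = none := dif_pos rfl

lemma step_none_of_ne {j : J} (h : j ≠ j₀) :
    step (none : FrameIndex j₀) j = some ⟨0, fun _ => j, h⟩ := dif_neg h

/-- Dropping the last entry gives the predecessor, and the empty tuple is its own predecessor
through $j_0$. Truncated subtraction makes the length bound valid in that case too. -/
lemma exists_step (i : FrameIndex j₀) : ∃ p j, i = step p j ∧ p.length ≤ i.length - 1 := by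
  rcases i with _ | ⟨_ | k, j, hj⟩
  · exact ⟨none, j₀, step_none_self.symm, le_rfl⟩
  · refine ⟨none, j 0, ?_, le_rfl⟩
    rw [step_none_of_ne hj]
    congr 3
    ext l
    rw [show l = 0 from Fin.ext (by omega)]
  · refine ⟨some ⟨k, fun l => j l.castSucc, hj⟩, j (Fin.last _), ?_, le_rfl⟩
    simp only [step]
    congr 3
    exact (Fin.snoc_init_self (α := fun _ => J) j).symm

/-- The length of the result separates the cases: zero for the empty tuple with $j_0$ appended, one
for it with any other entry, at least two for a nonempty tuple. Within a case the last entry and the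
initial segment can be read off. -/
lemma step_injective : Function.Injective fun p : FrameIndex j₀ × J => step p.1 p.2 := by
  rintro ⟨_ | ⟨k, j, hj⟩, l⟩ ⟨_ | ⟨k', j', hj'⟩, l'⟩ h
  · by_cases hl : l = j₀ <;> by_cases hl' : l' = j₀
    · rw [hl, hl']
    · simp [step, hl, hl'] at h
    · simp [step, hl, hl'] at h
    · simp only [step_none_of_ne hl, step_none_of_ne hl', Option.some.injEq, Sigma.mk.injEq,
        heq_eq_eq, true_and, Subtype.mk.injEq] at h
      rw [congrFun h 0]
  · by_cases hl : l = j₀ <;> simp [step, hl] at h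
  · by_cases hl' : l' = j₀ <;> simp [step, hl'] at h
  · simp only [step, Option.some.injEq, Sigma.mk.injEq, Nat.add_right_cancel_iff] at h
    obtain ⟨rfl, h⟩ := h
    simp only [heq_eq_eq, Subtype.mk.injEq] at h
    obtain ⟨h1, h2⟩ := Fin.snoc_injective2 (α := fun _ => J) h
    subst h1 h2
    rfl

variable (j₀) in
/-- Appending an entry is a bijection. -/
def stepEquiv : FrameIndex j₀ × J ≃ FrameIndex j₀ :=
  Equiv.ofBijective (fun p => step p.1 p.2) ⟨step_injective, fun i => by
    obtain ⟨p, j, h, -⟩ := exists_step i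
    exact ⟨(p, j), h.symm⟩⟩

@[simp] lemma stepEquiv_apply (p : FrameIndex j₀ × J) : stepEquiv j₀ p = step p.1 p.2 := rfl

lemma length_eq_zero {i : FrameIndex j₀} (h : i.length = 0) : i = none := by
  rcases i with _ | ⟨k, j⟩
  · rfl
  · exact absurd h (Nat.succ_ne_zero k)

/-- Induction on the length of a tuple. -/
lemma step_induction {p : FrameIndex j₀ → Prop} (h0 : p none) (h : ∀ i j, p i → p (step i j))
    (i : FrameIndex j₀) : p i := by
  suffices ∀ n, ∀ i : FrameIndex j₀, i.length ≤ n → p i from this _ i le_rfl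
  intro n
  induction n with
  | zero =>
    intro i hi
    rw [length_eq_zero (Nat.le_zero.1 hi)]
    exact h0
  | succ n ih =>
    intro i hi
    obtain ⟨q, j, rfl, hq⟩ := exists_step i
    exact h q j (ih q (by omega))

/-- Simultaneous induction on the lengths of two tuples. -/
lemma step_induction₂ {p : FrameIndex j₀ → FrameIndex j₀ → Prop} (h0 : p none none)
    (h : ∀ i i' j j', p i i' → p (step i j) (step i' j')) (i i' : FrameIndex j₀) : p i i' := by
  suffices ∀ n, ∀ i i' : FrameIndex j₀, i.length ≤ n → i'.length ≤ n → p i i' from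
    this _ i i' (le_max_left _ _) (le_max_right _ _)
  intro n
  induction n with
  | zero =>
    intro i i' hi hi'
    rw [length_eq_zero (Nat.le_zero.1 hi), length_eq_zero (Nat.le_zero.1 hi')]
    exact h0
  | succ n ih =>
    intro i i' hi hi'
    -- Tuples of different lengths can be shortened together, since an empty one stays empty.
    obtain ⟨q, j, rfl, hq⟩ := exists_step i
    obtain ⟨q', j', rfl, hq'⟩ := exists_step i'
    exact h q q' j j' (ih q q' (by omega) (by omega))

end FrameIndex

open FrameIndex

/-! ### The Parseval frame and the orthonormal basis of the range of $Q$ -/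

section Frame

variable {A : Type u} [CStarAlgebra A] [PartialOrder A] [StarOrderedRing A]

/-- A unit vector in a Parseval frame is orthogonal to the other vectors of the frame. -/
lemma IsParsevalFrame.inner_eq_zero {X : RightHilbertModule A} {J : Type*}
    {V : Submodule Aᵐᵒᵖ X} {m : J → X} (h : IsParsevalFrame V m) {j₀ j : J}
    (h0 : X.inner (m j₀) (m j₀) = 1) (hj : j ≠ j₀) : X.inner (m j) (m j₀) = 0 := by
  classical
  have hs := h.2 (m j₀) (h.1 j₀)
  have hstar : ∀ j, X.inner (m j₀) (m j) = star (X.inner (m j) (m j₀)) := fun j =>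
    (X.star_inner _ _).symm
  -- The term of $j_0$ already equals the total $1$, so the positive term of $j$ must vanish.
  have hle := sum_le_hasSum {j₀, j} (fun i _ => by
    rw [hstar]; exact star_mul_self_nonneg _) hs
  rw [Finset.sum_pair hj.symm, h0, mul_one, add_le_iff_nonpos_right, hstar] at hle
  exact (CStarRing.star_mul_self_eq_zero_iff _).1 (le_antisymm hle (star_mul_self_nonneg _))

/-- An orthonormal family that satisfies the Parseval identity for `y` has `y` in its closed
span. -/
lemma IsOrthonormalFamily.mem_closure_span {X : RightHilbertModule A} {ι : Type*} {e : ι → X}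
    (he : IsOrthonormalFamily e) {y : X}
    (hy : HasSum (fun i => X.inner y (e i) * X.inner (e i) y) (X.inner y y)) :
    y ∈ closure (Submodule.span Aᵐᵒᵖ (Set.range e) : Set X) := by
  classical
  rw [Metric.mem_closure_iff]
  intro ε hε
  obtain ⟨s, hs⟩ := hy.exists_norm_sub_lt (sq_pos_of_pos hε)
  refine ⟨∑ i ∈ s, e i <• X.inner (e i) y, Submodule.sum_mem _ fun i _ =>
    Submodule.smul_mem _ _ (Submodule.subset_span ⟨i, rfl⟩), ?_⟩
  set w := ∑ i ∈ s, e i <• X.inner (e i) y with hw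
  have h1 : X.inner y w = ∑ i ∈ s, X.inner y (e i) * X.inner (e i) y := by
    refine (X.pre.inner_sum_right s y _).trans (Finset.sum_congr rfl fun i _ => ?_)
    exact X.inner_smul_right _ _ _
  have h2 : ∀ i ∈ s, X.inner (e i) w = X.inner (e i) y := by
    intro i hi
    refine (X.pre.inner_sum_right s (e i) _).trans ?_
    rw [Finset.sum_eq_single_of_mem i hi]
    · refine (X.inner_smul_right _ _ _).trans ?_
      rw [he.1 i, one_mul]
    · intro j _ hj
      refine (X.inner_smul_right _ _ _).trans ?_
      rw [he.2 i j hj.symm, zero_mul]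
  -- Orthonormality makes $w$ the projection of $y$ onto the span of finitely many `e i`. Hence
  -- $\|y-w\|^2$ is exactly the norm of the remainder of the Parseval sum.
  have h3 : X.inner w w = X.inner w y := by
    have hl : ∀ z, X.inner w z = ∑ i ∈ s, star (X.inner (e i) y) * X.inner (e i) z := fun z => by
      refine (X.pre.inner_sum_left s z _).trans (Finset.sum_congr rfl fun i _ => ?_)
      exact X.pre.inner_smul_left _ _ _
    rw [hl, hl]
    exact Finset.sum_congr rfl fun i hi => by rw [h2 i hi]
  have h4 : X.inner (y - w) (y - w) = X.inner y y - X.inner y w := by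
    have e1 : X.inner (y - w) (y - w) = X.inner y (y - w) - X.inner w (y - w) :=
      X.pre.inner_sub_left _ _ _
    have e2 : X.inner y (y - w) = X.inner y y - X.inner y w := X.pre.inner_sub_right _ _ _
    have e3 : X.inner w (y - w) = X.inner w y - X.inner w w := X.pre.inner_sub_right _ _ _
    rw [e1, e2, e3, h3, sub_self, sub_zero]
  rw [dist_eq_norm, X.norm_eq, h4, h1]
  exact (Real.sqrt_lt' hε).2 hs

variable {M : CStarCorrespondence A} {J : Type*} {j₀ : J} {m : J → M}
  {hm : M.inner (m j₀) (m j₀) = 1} {X : RightHilbertModule A} {D : InnerEquiv X (X.tensor M)}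
  {φ : X} {e : FrameIndex j₀ → X}

/-- $D$ preserves inner products, so the Gram matrix of $e$ satisfies a recursion along `step`. -/
lemma inner_eq_of_step (he : ∀ i j, D (e (step i j)) = tmul (e i) (m j)) (i i' : FrameIndex j₀)
    (j j' : J) : X.inner (e (step i j)) (e (step i' j')) =
      M.inner (m j) (X.inner (e i) (e i') • m j') := by
  have h : (X.tensor M).inner (D (e (step i j))) (D (e (step i' j'))) =
    X.inner (e (step i j)) (e (step i' j')) := D.inner_map _ _
  rw [← h, he, he, inner_tmul_right]

/-- Writing the empty tuple as itself with $j_0$ appended, the Gram recursion removes the last entry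
of `i`. What remains is either the orthogonality of $m_j$ and $m_{j_0}$ for $j\ne j_0$, or the
induction hypothesis. Orthonormality of the whole family $(m_j)$ is not needed. -/
lemma inner_none_eq_zero (hframe : IsParsevalFrame (X := M.toRightHilbertModule) ⊤ m)
    (hm : M.inner (m j₀) (m j₀) = 1) (h0 : X.inner (e none) (e none) = 1)
    (he : ∀ i j, D (e (step i j)) = tmul (e i) (m j)) (i : FrameIndex j₀) (hi : i ≠ none) :
    X.inner (e i) (e none) = 0 := by
  revert hi
  refine step_induction (p := fun i => i ≠ none → X.inner (e i) (e none) = 0)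
    (fun h => absurd rfl h) (fun i j ih hne => ?_) i
  have h := inner_eq_of_step he i none j j₀
  rw [step_none_self] at h
  rw [h]
  by_cases hi : i = none
  · subst hi
    have hj : j ≠ j₀ := fun hj => hne (by rw [hj, step_none_self])
    rw [h0, one_smul]
    exact hframe.inner_eq_zero hm hj
  · rw [ih hi, zero_smul]
    exact M.pre.inner_zero_right _

lemma isOrthonormalFamily_of_step (hm : IsOrthonormalFamily (X := M.toRightHilbertModule) m)
    (h0 : X.inner (e none) (e none) = 1) (he : ∀ i j, D (e (step i j)) = tmul (e i) (m j)) :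
    IsOrthonormalFamily e := by
  classical
  have key : ∀ i i', X.inner (e i) (e i') = if i = i' then 1 else 0 := by
    refine step_induction₂ ?_ fun i i' j j' ih => ?_
    · rw [h0, if_pos rfl]
    · rw [inner_eq_of_step he, ih]
      have hinj : step i j = step i' j' ↔ i = i' ∧ j = j' := by
        refine ⟨fun h => ?_, fun h => by rw [h.1, h.2]⟩
        exact Prod.mk.inj (step_injective (a₁ := (i, j)) (a₂ := (i', j')) h)
      by_cases hi : i = i'
      · rw [if_pos hi, one_smul]
        by_cases hj : j = j'
        · rw [if_pos (hinj.2 ⟨hi, hj⟩), hj]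
          exact hm.1 j'
        · rw [if_neg fun h => hj (hinj.1 h).2]
          exact hm.2 j j' hj
      · rw [if_neg hi, if_neg fun h => hi (hinj.1 h).1, zero_smul]
        exact M.pre.inner_zero_right _
  exact ⟨fun i => by rw [key, if_pos rfl], fun i j hij => by rw [key, if_neg hij]⟩

/-- On $\phi\cdot A$ only the term of $\phi$ survives. In the inductive step, reindexing by
`stepEquiv` and applying $D$ turns the sum into the one for $e_i\otimes m_j$ on the range of
$q_k\otimes\mathrm{id}$. -/
lemma hasSum_realizationMap (hframe : IsParsevalFrame (X := M.toRightHilbertModule) ⊤ m)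
    (hm : M.inner (m j₀) (m j₀) = 1) (hφ : X.inner φ φ = 1) (h0 : e none = φ)
    (he : ∀ i j, D (e (step i j)) = tmul (e i) (m j)) (k : ℕ)
    (z : (RightHilbertModule.self A).tensorPow M k) :
    HasSum (fun i => X.inner (realizationMap D φ hφ k z) (e i) *
      X.inner (e i) (realizationMap D φ hφ k z))
      (((RightHilbertModule.self A).tensorPow M k).inner z z) := by
  induction k with
  | zero =>
    rw [← (realizationMap D φ hφ 0).inner_apply]
    change HasSum (fun i => X.inner (φ <• (show A from z)) (e i) *
      X.inner (e i) (φ <• (show A from z))) (X.inner (φ <• (show A from z)) (φ <• (show A from z)))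
    have hl : ∀ x, X.inner (φ <• (show A from z)) x = star (show A from z) * X.inner φ x :=
      fun x => X.pre.inner_smul_left _ _ _
    have hs := hasSum_single (f := fun i => X.inner (φ <• (show A from z)) (e i) *
      X.inner (e i) (φ <• (show A from z))) none fun i hi => by
        have := inner_none_eq_zero hframe hm (by rwa [h0]) he i hi
        rw [h0] at this
        change _ * X.inner (e i) (φ <• (show A from z)) = 0
        rw [X.inner_smul_right, this, zero_mul, mul_zero]
    refine Eq.mp ?_ hs
    congr 1
    rw [h0, X.inner_smul_right, X.inner_smul_right, hl, hφ]
    simp only [mul_one]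
    exact congrArg (star (show A from z) * ·) (one_mul (show A from z))
  | succ k ih =>
    have hs := (realizationMap D φ hφ k).hasSum_tensorId ih (fun n => hframe.2 n trivial) z
    rw [← (stepEquiv j₀).hasSum_iff]
    refine Eq.mp ?_ hs
    congr 1
    funext p
    have hD : ∀ x y, X.inner x y = (X.tensor M).inner (D x) (D y) := fun x y =>
      (D.inner_map x y).symm
    change _ = X.inner (realizationMap D φ hφ (k + 1) z) (e (step p.1 p.2)) *
      X.inner (e (step p.1 p.2)) (realizationMap D φ hφ (k + 1) z)
    rw [hD, hD (e _), apply_realizationMap_succ, he]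

/-- A family `(e i)` such that `e ∅ = φ` and `D (e (i, j)) = e i ⊗ m j` is a Parseval frame for the
range of `Q`, and an orthonormal basis if `(m j)` is orthonormal. -/
theorem IsRealization.isParsevalFrame
    {R : InnerEquiv (filterLimit M (m j₀) hm) ((filterLimit M (m j₀) hm).tensor M)}
    {Q : InnerMap (filterLimit M (m j₀) hm) X} (h : IsRealization D φ R Q)
    (hframe : IsParsevalFrame (X := M.toRightHilbertModule) ⊤ m) (hφ : X.inner φ φ = 1)
    (h0 : e none = φ) (he : ∀ i j, D (e (step i j)) = tmul (e i) (m j)) :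
    IsParsevalFrame Q.range e ∧ (IsOrthonormalFamily (X := M.toRightHilbertModule) m →
      IsOrthonormalModuleBasis Q.range e) := by
  have hmem : ∀ i, e i ∈ Q.range := by
    refine step_induction ⟨_, h.base.trans h0.symm⟩ ?_
    rintro i j ⟨n, hn⟩
    -- If $e_i=Q(n)$, the intertwining relation makes $R^{-1}(n\otimes m_j)$ a preimage of the next
    -- vector.
    refine ⟨R.symm (tmul n (m j)), EquivLike.injective D ?_⟩
    refine (h.intertwine _).trans ?_
    rw [InnerEquiv.apply_symm_apply, InnerMap.tensorId_tmul, he]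
    exact congrArg (tmul · (m j)) hn
  have hsum : ∀ y ∈ Q.range,
      HasSum (fun i => X.inner y (e i) * X.inner (e i) y) (X.inner y y) := by
    rintro _ ⟨z, rfl⟩
    -- The identity is known on the images of the $\iota^k$, whose union is dense in $M_\infty$.
    refine Eq.mp ?_ (Q.hasSum_of_dense e (fun z => filterLimit_induction
      (p := fun z => z ∈ closure {z | HasSum (fun i => X.inner (Q z) (e i) * X.inner (e i) (Q z))
        ((filterLimit M (m j₀) hm).inner z z)}) isClosed_closure
      (fun k x => subset_closure ?_) z) z)
    · rw [← Q.inner_apply z z]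
      rfl
    · change HasSum _ _
      rw [(filterLimitMap M (m j₀) hm k).inner_apply, h.apply_limitMap hφ]
      exact hasSum_realizationMap hframe hm hφ h0 he k x
  refine ⟨⟨hmem, hsum⟩, fun hon => ?_⟩
  have heon := isOrthonormalFamily_of_step hon (by rwa [h0]) he
  exact ⟨heon, hmem, fun y hy => heon.mem_closure_span (hsum y hy)⟩

/-- Since $D^{k+1}=(D^k\otimes\mathrm{id})\circ D$, one has $D\circ
D^{-(k+1)}=D^{-k}\otimes\mathrm{id}$, which acts on all but the last tensor factor. Appending $j_0$
to the empty tuple gives the scaling equation. -/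
lemma frameVector_step (hD : D φ = tmul φ (m j₀)) (i : FrameIndex j₀) (j : J) :
    D (frameVector D φ j₀ m (step i j)) = tmul (frameVector D φ j₀ m i) (m j) := by
  have hsymm : ∀ k (z : X.tensorPow M (k + 1)), D ((D.dilationPow (k + 1)).symm z) =
      ((D.dilationPow k).tensorId M).symm z := fun k z => D.apply_symm_apply _
  have htmul : ∀ k (z : X.tensorPow M k) (n : M), ((D.dilationPow k).tensorId M).symm (tmul z n) =
      tmul ((D.dilationPow k).symm z) n := fun k z n => by
    refine EquivLike.injective ((D.dilationPow k).tensorId M) ?_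
    refine (InnerEquiv.apply_symm_apply _ _).trans ?_
    refine Eq.trans ?_ (InnerEquiv.tensorId_tmul _ _ _ _).symm
    rw [InnerEquiv.apply_symm_apply]
  rcases i with _ | ⟨k, i, hi⟩
  · by_cases h : j = j₀
    · subst h
      rw [step_none_self]
      exact hD
    · rw [step_none_of_ne h]
      exact (hsymm 0 _).trans (htmul 0 φ (m j))
  · refine (hsymm (k + 1) _).trans ((htmul (k + 1) _ _).trans ?_)
    have h1 : (fun l : Fin (k + 1) => m (Fin.snoc (α := fun _ => J) i j l.castSucc)) =
        fun l => m (i l) := funext fun l => by rw [Fin.snoc_castSucc]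
    have h2 : Fin.snoc (α := fun _ => J) i j (Fin.last (k + 1)) = j := Fin.snoc_last _ _
    change tmul ((D.dilationPow (k + 1)).symm (tprod φ fun l : Fin (k + 1) =>
      m (Fin.snoc (α := fun _ => J) i j l.castSucc)))
      (m (Fin.snoc (α := fun _ => J) i j (Fin.last (k + 1)))) = _
    rw [h1, h2]
    rfl

end Frame

/-! ### Identification of $X_L$ with $X\otimes_A M_L$ -/

section TransferTensor

variable {A : Type u} [CStarAlgebra A] [PartialOrder A] [StarOrderedRing A]

lemma RightHilbertModule.eq_zero_of_inner_self {X : RightHilbertModule A} {x : X}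
    (h : X.inner x x = 0) : x = 0 := by
  rw [← norm_eq_zero, X.norm_eq, h, norm_zero, Real.sqrt_zero]

/-- The algebraic tensor product is taken over $\mathbb{C}$, so balancing over $A$ arises only in
the completion: the difference is orthogonal to every elementary tensor and hence has length zero.
-/
lemma RightHilbertModule.op_smul_tmul {X : RightHilbertModule A} {M : CStarCorrespondence A}
    (x : X) (a : A) (m : M) : (tmul (x <• a) m : X.tensor M) = tmul x (a • m) := by
  rw [← sub_eq_zero]
  refine eq_zero_of_inner_self ?_
  refine ((X.tensor M).pre.inner_sub_left _ _ _).trans ?_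
  have hl : ∀ y, X.inner (x <• a) y = star a * X.inner x y := fun y => X.pre.inner_smul_left _ _ _
  have h : ∀ y, (X.tensor M).pre.inner (tmul (x <• a) m) y =
      (X.tensor M).pre.inner (tmul x (a • m)) y := by
    intro y
    refine tensor_induction (p := fun y => (X.tensor M).inner (tmul (x <• a) m) y =
      (X.tensor M).inner (tmul x (a • m)) y) (isClosed_eq
        (continuous_const.hilbert_inner continuous_id)
        (continuous_const.hilbert_inner continuous_id)) (fun z w hz hw => ?_) (fun y n => ?_) y
    · rw [(X.tensor M).inner_add_right, (X.tensor M).inner_add_right, hz, hw]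
    · rw [inner_tmul_right, inner_tmul_right, hl, M.inner_left_smul, smul_smul]
  rw [h, sub_self]

lemma RightHilbertModule.complex_smul_tmul {X : RightHilbertModule A} {M : CStarCorrespondence A}
    (c : ℂ) (x : X) (m : M) : (tmul (c • x) m : X.tensor M) = c • tmul x m := by
  rw [PreHilbertModule.complex_smul_eq (A := A) c (tmul x m), ← tmul_smul,
    ← PreHilbertModule.complex_smul_eq (A := A) c m,
    PreHilbertModule.complex_smul_eq (A := A) c x, op_smul_tmul, smul_assoc, one_smul]

variable {α : A →⋆ₐ[ℂ] A} (L : TransferOperator α)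

lemma TransferOperator.denseRange_toM : DenseRange L.toM :=
  UniformSpace.Completion.denseRange_coe (α := L.pre.toPreHilbertModule.Space)

lemma TransferOperator.smul_toM (a b : A) : a • L.toM b = L.toM (a * b) :=
  (UniformSpace.Completion.coe_smul (X := L.pre.toPreHilbertModule.Space) a b).symm

lemma TransferOperator.toM_op_smul (a b : A) : L.toM a <• b = L.toM (a * α b) :=
  (UniformSpace.Completion.coe_smul (X := L.pre.toPreHilbertModule.Space)
    (MulOpposite.op b) a).symm

variable (X : RightHilbertModule A)

lemma TransferOperator.op_smul_tmul_one (x : X) (a : A) :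
    (tmul (x <• a) (L.toM 1) : X.tensor L.correspondence) = tmul x (L.toM a) := by
  rw [op_smul_tmul, L.smul_toM, mul_one]

lemma TransferOperator.inner_tmul_one (x y : X) :
    (X.tensor L.correspondence).inner (tmul x (L.toM 1)) (tmul y (L.toM 1)) =
      L.toLinearMap (X.inner x y) := by
  rw [inner_tmul_right, L.smul_toM, L.inner_toM, star_one, one_mul, mul_one]

/-- The map `X_L → X ⊗_A M_L`, `x ↦ x ⊗ 1`. -/
def TransferOperator.tmulOne : X →ₗ[ℂ] X.tensor L.correspondence where
  toFun x := tmul x (L.toM 1)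
  map_add' x y := add_tmul x y _
  map_smul' c x := complex_smul_tmul c x _

/-- `L` is bounded below on positive elements. -/
def TransferOperator.IsBoundedBelow : Prop :=
  ∃ K : ℝ, 0 ≤ K ∧ ∀ a : A, 0 ≤ a → ‖a‖ ≤ K * ‖L.toLinearMap a‖

variable {L}

/-- Apply the lower bound to $\langle x,x\rangle\ge 0$ and use $\langle x\otimes 1,x\otimes
1\rangle=L(\langle x,x\rangle)$. -/
lemma TransferOperator.IsBoundedBelow.norm_le (hL : L.IsBoundedBelow) :
    ∃ K : ℝ, 0 ≤ K ∧ ∀ x : X, ‖x‖ ≤ K * ‖L.tmulOne X x‖ := by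
  obtain ⟨K, hK0, hK⟩ := hL
  refine ⟨√K, Real.sqrt_nonneg _, fun x => ?_⟩
  rw [X.norm_eq, (X.tensor L.correspondence).norm_eq, ← Real.sqrt_mul hK0]
  refine Real.sqrt_le_sqrt ((hK _ (X.inner_self_nonneg x)).trans_eq ?_)
  exact congrArg (K * ‖·‖) (L.inner_tmul_one X x x).symm

lemma TransferOperator.continuous_tmulOne : Continuous (L.tmulOne X) :=
  continuous_tmul_left _

/-- The lower norm bound gives injectivity and, as $X$ is complete, closed range. The range contains
$x\otimes a=(x\cdot a)\otimes 1$, and the image of $A$ is dense in $M_L$. -/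
lemma TransferOperator.IsBoundedBelow.bijective (hL : L.IsBoundedBelow) :
    Function.Bijective (L.tmulOne X) := by
  obtain ⟨K, hK0, hK⟩ := hL.norm_le X
  have hanti : AntilipschitzWith ⟨K, hK0⟩ (L.tmulOne X) :=
    AddMonoidHomClass.antilipschitz_of_bound _ hK
  refine ⟨hanti.injective, ?_⟩
  have hu : UniformContinuous (L.tmulOne X) :=
    uniformContinuous_addMonoidHom_of_continuous (f := (L.tmulOne X).toAddMonoidHom)
      (TransferOperator.continuous_tmulOne X)
  have hcl : IsClosed (Set.range (L.tmulOne X)) := hanti.isClosed_range hu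
  refine tensor_induction (p := fun z => z ∈ Set.range (L.tmulOne X)) hcl ?_ fun x n => ?_
  · rintro _ _ ⟨z, rfl⟩ ⟨w, rfl⟩
    exact ⟨z + w, map_add _ _ _⟩
  · refine L.denseRange_toM.induction_on (p := fun n => tmul x n ∈ Set.range (L.tmulOne X)) n
      (hcl.preimage (continuous_tmul_right x)) fun a => ⟨x <• a, L.op_smul_tmul_one X x a⟩

/-- The isomorphism of `X_L` onto `X ⊗_A M_L`, `x ↦ x ⊗ 1`. -/
def TransferOperator.IsBoundedBelow.tmulEquiv (hL : L.IsBoundedBelow) :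
    X ≃ₗ[ℂ] X.tensor L.correspondence :=
  LinearEquiv.ofBijective (L.tmulOne X) (hL.bijective X)

lemma TransferOperator.IsBoundedBelow.tmulEquiv_apply (hL : L.IsBoundedBelow) (x : X) :
    hL.tmulEquiv X x = tmul x (L.toM 1) := rfl

lemma TransferOperator.IsBoundedBelow.tmulEquiv_op_smul (hL : L.IsBoundedBelow) (x : X) (a : A) :
    hL.tmulEquiv X (x <• a) = tmul x (L.toM a) := L.op_smul_tmul_one X x a

lemma TransferOperator.IsBoundedBelow.tmulEquiv_op_smul_map (hL : L.IsBoundedBelow) (x : X)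
    (a : A) : hL.tmulEquiv X (x <• α a) = hL.tmulEquiv X x <• a := by
  rw [hL.tmulEquiv_op_smul, hL.tmulEquiv_apply, ← tmul_smul, L.toM_op_smul, one_mul]

variable {X}

/-- The isomorphism `X → X ⊗_A M_L`, `x ↦ D x ⊗ 1`, defined by a dilation `D` of `X`. -/
def IsTransferDilation.toTensor {D : X ≃ₗ[ℂ] X} (hD : IsTransferDilation L D)
    (hL : L.IsBoundedBelow) : InnerEquiv X (X.tensor L.correspondence) where
  toLinearEquiv :=
    { D.trans (hL.tmulEquiv X) with
      map_smul' := fun a x => by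
        change hL.tmulEquiv X (D (x <• a.unop)) = hL.tmulEquiv X (D x) <• a.unop
        rw [hD.map_smul, hL.tmulEquiv_op_smul_map] }
  inner_map x y := (L.inner_tmul_one X (D x) (D y)).trans (hD.inner_map x y)

lemma IsTransferDilation.toTensor_apply {D : X ≃ₗ[ℂ] X} (hD : IsTransferDilation L D)
    (hL : L.IsBoundedBelow) (x : X) : hD.toTensor hL x = tmul (D x) (L.toM 1) := rfl

/-- The dilation `D` of `X` defined by an isomorphism `U : X → X ⊗_A M_L`, such that
`U x = D x ⊗ 1`. -/
def InnerEquiv.toDilation (U : InnerEquiv X (X.tensor L.correspondence))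
    (hL : L.IsBoundedBelow) : X ≃ₗ[ℂ] X :=
  LinearEquiv.trans
    ({ U.toLinearEquiv with map_smul' := fun c x => U.toInnerMap.map_complex_smul c x } :
      X ≃ₗ[ℂ] X.tensor L.correspondence)
    (hL.tmulEquiv X).symm

lemma InnerEquiv.tmulEquiv_toDilation (U : InnerEquiv X (X.tensor L.correspondence))
    (hL : L.IsBoundedBelow) (x : X) : hL.tmulEquiv X (U.toDilation hL x) = U x :=
  (hL.tmulEquiv X).apply_symm_apply _

lemma InnerEquiv.isTransferDilation_toDilation (U : InnerEquiv X (X.tensor L.correspondence))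
    (hL : L.IsBoundedBelow) : IsTransferDilation L (U.toDilation hL) where
  map_smul x a := by
    refine (hL.tmulEquiv X).injective ?_
    rw [hL.tmulEquiv_op_smul_map, U.tmulEquiv_toDilation, U.tmulEquiv_toDilation]
    exact map_smul U.toInnerMap _ _
  inner_map x y := by
    rw [← L.inner_tmul_one, ← hL.tmulEquiv_apply, ← hL.tmulEquiv_apply,
      U.tmulEquiv_toDilation, U.tmulEquiv_toDilation]
    exact U.inner_map x y

variable {m : L.correspondence} {hm : L.correspondence.inner m m = 1} {D : X ≃ₗ[ℂ] X} {φ : X}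

/-- The shift relation is given only on $z\otimes a$ with $a\in A$; density of $A$ in $M_L$ and of
sums of elementary tensors extends it to $M_L^{\otimes(k+1)}$. -/
lemma IsTransferRealization.isRealization (hL : L.IsBoundedBelow) (hD : IsTransferDilation L D)
    {R : filterLimit L.correspondence m hm ≃ₗ[ℂ] filterLimit L.correspondence m hm}
    {Q : InnerMap (filterLimit L.correspondence m hm) X} (h : IsTransferRealization D φ R Q) :
    IsRealization (hD.toTensor hL) φ (h.dilation.toTensor hL) Q where
  shift k z := by
    refine tensor_induction (p := fun z => h.dilation.toTensor hL
        (filterLimitMap L.correspondence m hm (k + 1) z) =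
      (filterLimitMap L.correspondence m hm k).tensorId L.correspondence z) (isClosed_eq
        ((InnerEquiv.isometry _).continuous.comp (InnerMap.isometry _).continuous)
        (InnerMap.isometry _).continuous) (fun z w hz hw => ?_) (fun z n => ?_) z
    · refine (congrArg _ (map_add (filterLimitMap L.correspondence m hm (k + 1)) z w)).trans ?_
      refine (map_add (h.dilation.toTensor hL).toInnerMap _ _).trans ?_
      refine Eq.trans ?_
        (map_add ((filterLimitMap L.correspondence m hm k).tensorId L.correspondence) z w).symm
      exact congrArg₂ _ hz hw
    · refine L.denseRange_toM.induction_on (p := fun n => h.dilation.toTensor hL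
          (filterLimitMap L.correspondence m hm (k + 1) (tmul z n)) =
        (filterLimitMap L.correspondence m hm k).tensorId L.correspondence (tmul z n)) n
        (isClosed_eq ((InnerEquiv.isometry _).continuous.comp
          ((InnerMap.isometry _).continuous.comp (continuous_tmul_right z)))
          ((InnerMap.isometry _).continuous.comp (continuous_tmul_right z))) fun a => ?_
      rw [h.dilation.toTensor_apply, h.shift, L.op_smul_tmul_one, InnerMap.tensorId_tmul]
  base := h.base
  intertwine z := by
    rw [hD.toTensor_apply, h.dilation.toTensor_apply, InnerMap.tensorId_tmul, h.intertwine]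

lemma IsRealization.isTransferRealization (hL : L.IsBoundedBelow) (hD : IsTransferDilation L D)
    {R : InnerEquiv (filterLimit L.correspondence m hm)
      ((filterLimit L.correspondence m hm).tensor L.correspondence)}
    {Q : InnerMap (filterLimit L.correspondence m hm) X}
    (h : IsRealization (hD.toTensor hL) φ R Q) :
    IsTransferRealization D φ (R.toDilation hL) Q where
  dilation := R.isTransferDilation_toDilation hL
  shift k z a := by
    refine (hL.tmulEquiv _).injective ?_
    rw [R.tmulEquiv_toDilation, hL.tmulEquiv_op_smul]
    exact (h.shift k (tmul z (L.toM a))).trans (InnerMap.tensorId_tmul _ _ _ _)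
  base := h.base
  intertwine z := by
    refine (hL.tmulEquiv X).injective ?_
    refine (h.intertwine z).trans ?_
    rw [← R.tmulEquiv_toDilation hL, hL.tmulEquiv_apply, InnerMap.tensorId_tmul]
    rfl

/-- Realizations in the two pictures correspond through the bijection $x\mapsto x\otimes 1$, so both
existence and uniqueness carry over. -/
theorem IsTransferDilation.existsUnique_isTransferRealization (hL : L.IsBoundedBelow)
    (hD : IsTransferDilation L D) (hφ : IsScalingFunction m (hD.toTensor hL) φ) :
    ∃! p : (filterLimit L.correspondence m hm ≃ₗ[ℂ] filterLimit L.correspondence m hm) ×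
      InnerMap (filterLimit L.correspondence m hm) X, IsTransferRealization D φ p.1 p.2 := by
  obtain ⟨⟨R, Q⟩, hRQ, huniq⟩ := existsUnique_isRealization (hm := hm) hφ
  refine ⟨(R.toDilation hL, Q), hRQ.isTransferRealization hL hD, fun p hp => ?_⟩
  have h := huniq (hp.dilation.toTensor hL, p.2) (hp.isRealization hL hD)
  have h1 : hp.dilation.toTensor hL = R := congrArg Prod.fst h
  have h2 : p.2 = Q := congrArg Prod.snd h
  refine Prod.ext (LinearEquiv.ext fun z => (hL.tmulEquiv _).injective ?_) h2
  rw [R.tmulEquiv_toDilation, ← h1]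
  rfl

end TransferTensor

/-! ### Local homeomorphisms of compact spaces -/

section LocalHomeomorphism

variable {C : Type u} [TopologicalSpace C] [CompactSpace C] [T2Space C]

/-- Finitely many open sets on which $\sigma$ is injective cover $C$, and each contains at most one
point of a given fibre. -/
lemma IsLocalHomeomorph.exists_card_fibre_le {σ : C(C, C)} (hσ : IsLocalHomeomorph σ) :
    ∃ n : ℕ, ∀ c, Nat.card (σ ⁻¹' {c}) ≤ n := by
  choose e he heq using hσ
  obtain ⟨s, hs⟩ := isCompact_univ.elim_finite_subcover (fun c => (e c).source)
    (fun c => (e c).open_source) fun c _ => Set.mem_iUnion.2 ⟨c, he c⟩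
  refine ⟨s.card, fun c => ?_⟩
  have hx : ∀ d : σ ⁻¹' {c}, ∃ i : s, d.1 ∈ (e i).source := fun d => by
    obtain ⟨i, hi, hd⟩ := Set.mem_iUnion₂.1 (hs (Set.mem_univ d.1))
    exact ⟨⟨i, hi⟩, hd⟩
  choose f hf using hx
  have hinj : Function.Injective f := by
    intro d d' hdd
    refine Subtype.ext ((e (f d)).injOn (hf d) (hdd ▸ hf d') ?_)
    rw [← heq]
    exact d.2.trans d'.2.symm
  exact (Nat.card_le_card_of_injective f hinj).trans_eq (by simp)

/-- For $f\ge 0$, the value $f(d)$ is at most the sum of $f$ over the fibre through $d$, which is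
$|\sigma^{-1}(\sigma(d))|\,L(f)(\sigma(d))$. -/
lemma isBoundedBelow_averagingTransfer {σ : C(C, C)} (hσ : IsLocalHomeomorph σ) :
    (averagingTransfer σ hσ).IsBoundedBelow := by
  obtain ⟨n, hn⟩ := hσ.exists_card_fibre_le
  refine ⟨n, Nat.cast_nonneg n, fun f hf => ?_⟩
  rw [ContinuousMap.norm_le _ (by positivity)]
  intro d
  have hfin := finite_fibre hσ (σ d)
  have hfI : Fintype (σ ⁻¹' {σ d}) := Fintype.ofFinite _
  have hpos : 0 < Nat.card (σ ⁻¹' {σ d}) := by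
    have : Nonempty (σ ⁻¹' {σ d}) := ⟨⟨d, rfl⟩⟩
    exact Nat.card_pos
  have hf' : ∀ c, 0 ≤ f c := fun c => (ContinuousMap.le_def.1 hf) c
  have h1 : f d ≤ ∑ i : σ ⁻¹' {σ d}, f i :=
    Finset.single_le_sum (f := fun i : σ ⁻¹' {σ d} => f i) (fun i _ => hf' i)
      (Finset.mem_univ ⟨d, rfl⟩)
  have h2 : ∑ i : σ ⁻¹' {σ d}, f i =
      (Nat.card (σ ⁻¹' {σ d}) : ℂ) * (averagingTransfer σ hσ).toLinearMap f (σ d) := by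
    change _ = _ * fibreAverage σ f (σ d)
    rw [fibreAverage, finsum_eq_sum_of_fintype, mul_inv_cancel_left₀]
    exact_mod_cast hpos.ne'
  calc ‖f d‖ ≤ ‖∑ i : σ ⁻¹' {σ d}, f i‖ := CStarAlgebra.norm_le_norm_of_nonneg_of_le (hf' d) h1
    _ = Nat.card (σ ⁻¹' {σ d}) * ‖(averagingTransfer σ hσ).toLinearMap f (σ d)‖ := by
      rw [h2, norm_mul, Complex.norm_natCast]
    _ ≤ n * ‖(averagingTransfer σ hσ).toLinearMap f‖ := by
      gcongr
      · exact hn _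
      · exact ContinuousMap.norm_coe_le_norm _ _

open FrameIndex

/-- From $D^{-1}(x\cdot\alpha(a))=D^{-1}(x)\cdot a$ one gets
$D^{-k}(x\cdot\alpha^k(a))=D^{-k}(x)\cdot a$. After $D$ cancels one inverse, the exponent of
$\alpha$ on the last factor equals the remaining power of $D^{-1}$, so that factor comes out as
$m_j$. -/
lemma transferFrameVector_step {α : C(C, ℂ) →⋆ₐ[ℂ] C(C, ℂ)} {L : TransferOperator α}
    {X : RightHilbertModule C(C, ℂ)} {D : X ≃ₗ[ℂ] X} (hD : IsTransferDilation L D) {φ : X}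
    {J : Type*} {j₀ : J} {m : J → C(C, ℂ)} (hφ : D φ = φ <• m j₀) (i : FrameIndex j₀) (j : J) :
    D (transferFrameVector α D φ j₀ m (step i j)) = transferFrameVector α D φ j₀ m i <• m j := by
  have hsymm : ∀ x a, D.symm (x <• α a) = D.symm x <• a := fun x a => by
    rw [LinearEquiv.symm_apply_eq, hD.map_smul, LinearEquiv.apply_symm_apply]
  have hiter : ∀ (k : ℕ) x a, D.symm^[k] (x <• α^[k] a) = D.symm^[k] x <• a := by
    intro k
    induction k with
    | zero => exact fun _ _ => rfl
    | succ k ih =>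
      intro x a
      rw [Function.iterate_succ_apply, Function.iterate_succ_apply' α, hsymm, ih,
        Function.iterate_succ_apply]
  rcases i with _ | ⟨k, i, hi⟩
  · by_cases h : j = j₀
    · subst h
      rw [step_none_self]
      exact hφ
    · rw [step_none_of_ne h]
      change D (D.symm (φ <• ∏ l : Fin 1, α^[(l : ℕ)] (m j))) = φ <• m j
      rw [LinearEquiv.apply_symm_apply, Fin.prod_univ_one]
      rfl
  · change D (D.symm^[k + 1 + 1] (φ <• ∏ l : Fin (k + 1 + 1),
      α^[(l : ℕ)] (m (Fin.snoc (α := fun _ => J) i j l)))) =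
      D.symm^[k + 1] (φ <• ∏ l : Fin (k + 1), α^[(l : ℕ)] (m (i l))) <• m j
    rw [Function.iterate_succ_apply', LinearEquiv.apply_symm_apply, Fin.prod_univ_castSucc,
      ← hiter, smul_smul, ← MulOpposite.op_mul]
    simp only [Fin.snoc_castSucc, Fin.snoc_last, Fin.val_castSucc, Fin.val_last]

end LocalHomeomorphism

end

/-! ### The theorem -/

theorem mainTheorem7 :
    (∀ (A : Type u) [CStarAlgebra A] [PartialOrder A] [StarOrderedRing A]
        (M : CStarCorrespondence A) (J : Type) [Countable J] (j₀ : J) (m : J → M)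
        (hm : M.inner (m j₀) (m j₀) = 1)
        (X : RightHilbertModule A) (D : InnerEquiv X (X.tensor M)) (φ : X),
        IsParsevalFrame (X := M.toRightHilbertModule) ⊤ m →
        IsScalingFunction (m j₀) D φ →
        (∃! p : InnerEquiv (filterLimit M (m j₀) hm) ((filterLimit M (m j₀) hm).tensor M) ×
            InnerMap (filterLimit M (m j₀) hm) X, IsRealization D φ p.1 p.2) ∧
        ∀ (R : InnerEquiv (filterLimit M (m j₀) hm) ((filterLimit M (m j₀) hm).tensor M))
          (Q : InnerMap (filterLimit M (m j₀) hm) X), IsRealization D φ R Q →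
          IsParsevalFrame Q.range (frameVector D φ j₀ m) ∧
          (IsOrthonormalFamily (X := M.toRightHilbertModule) m →
            IsOrthonormalModuleBasis Q.range (frameVector D φ j₀ m))) ∧
    (∀ (C : Type u) [TopologicalSpace C] [CompactSpace C] [T2Space C] (σ : C(C, C))
        (hσ : IsLocalHomeomorph σ) (_ : Function.Surjective σ)
        (J : Type) [Countable J] (j₀ : J) (m : J → C(C, ℂ))
        (hm : (averagingTransfer σ hσ).correspondence.inner
          ((averagingTransfer σ hσ).toM (m j₀)) ((averagingTransfer σ hσ).toM (m j₀)) = 1)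
        (X : RightHilbertModule C(C, ℂ)) (D : X ≃ₗ[ℂ] X) (φ : X),
        IsParsevalFrame (X := (averagingTransfer σ hσ).correspondence.toRightHilbertModule) ⊤
          (fun j => (averagingTransfer σ hσ).toM (m j)) →
        X.inner φ φ = 1 →
        IsTransferDilation (averagingTransfer σ hσ) D →
        D φ = φ <• m j₀ →
        (∃! p : (filterLimit (averagingTransfer σ hσ).correspondence
              ((averagingTransfer σ hσ).toM (m j₀)) hm ≃ₗ[ℂ]
            filterLimit (averagingTransfer σ hσ).correspondence
              ((averagingTransfer σ hσ).toM (m j₀)) hm) ×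
            InnerMap (filterLimit (averagingTransfer σ hσ).correspondence
              ((averagingTransfer σ hσ).toM (m j₀)) hm) X,
          IsTransferRealization D φ p.1 p.2) ∧
        ∀ (R : filterLimit (averagingTransfer σ hσ).correspondence
              ((averagingTransfer σ hσ).toM (m j₀)) hm ≃ₗ[ℂ]
            filterLimit (averagingTransfer σ hσ).correspondence
              ((averagingTransfer σ hσ).toM (m j₀)) hm)
          (Q : InnerMap (filterLimit (averagingTransfer σ hσ).correspondence
              ((averagingTransfer σ hσ).toM (m j₀)) hm) X),
          IsTransferRealization D φ R Q →
          IsParsevalFrame Q.range (transferFrameVector (pullbackHom σ) D φ j₀ m) ∧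
          (IsOrthonormalFamily (X := (averagingTransfer σ hσ).correspondence.toRightHilbertModule)
              (fun j => (averagingTransfer σ hσ).toM (m j)) →
            IsOrthonormalModuleBasis Q.range
              (transferFrameVector (pullbackHom σ) D φ j₀ m))) := by
  refine ⟨?_, ?_⟩
  · intro A _ _ _ M J _ j₀ m hm X D φ hframe hφ
    exact ⟨existsUnique_isRealization hφ, fun R Q h =>
      h.isParsevalFrame hframe hφ.1 rfl (frameVector_step hφ.2)⟩
  · intro C _ _ _ σ hσ _ J _ j₀ m hm X D φ hframe hφ hD hDφ
    have hL := isBoundedBelow_averagingTransfer hσ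
    have hscale : IsScalingFunction ((averagingTransfer σ hσ).toM (m j₀)) (hD.toTensor hL) φ :=
      -- $D\phi\otimes 1=(\phi\cdot m_0)\otimes 1=\phi\otimes m_0$.
      ⟨hφ, by rw [hD.toTensor_apply, hDφ, TransferOperator.op_smul_tmul_one]⟩
    refine ⟨hD.existsUnique_isTransferRealization hL hscale, fun R Q h => ?_⟩
    -- Only the recursion along `step` has to be checked, so the explicit product formula need not
    -- be compared with the tensor formula of part (1).
    refine (h.isRealization hL hD).isParsevalFrame
      (m := fun j => (averagingTransfer σ hσ).toM (m j)) hframe hφ rfl fun i j => ?_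
    rw [hD.toTensor_apply, transferFrameVector_step hD hDφ,
      TransferOperator.op_smul_tmul_one]
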